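/- Let $\Sigma=\{0,1\}$, let $\mathcal B=(\Sigma^*)^{\Sigma^*}$ be the set of string functions, and write $|\mathbf a|$ for the length of a string. **Machines.** An oracle Turing machine $M$ is a deterministic multi-tape Turing machine (finitely many states and work tapes, tape symbols $0$, $1$ and blank) with an input tape, an output tape, an oracle query tape and a read-only oracle answer tape. When $M$ queries the oracle $\varphi\in\mathcal B$ with the string $\mathbf b$ on its query tape, then in one time step $\mathbf b$ is removed, $\varphi(\mathbf b)$ replaces the content of the answer tape, and no head moves. Let $\mathrm{time}_{M^\varphi}(\mathbf a)\in\mathbb N\cup\{\infty\}$ be the number of steps of the computation of $M$ with oracle $\varphi$ on input $\mathbf a$. For $A\subseteq\mathcal B$, the machine $M$ computes $F\colon A\to\mathcal B$ if for all $\varphi\in A$ and $\mathbf a\in\Sigma^*$ this computation terminates with $F(\varphi)(\mathbf a)$ on the output tape. **Polynomial time.** For $\varphi\in\mathcal B$ let $|\varphi|(n)=\max\{|\varphi(\mathbf a)| : |\mathbf a|\le n\}$. The second-order polynomials are the members of the smallest class of functions $\mathbb N^{\mathbb N}\times\mathbb N\to\mathbb N$ that contains $(l,n)\mapsto p(n)$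 for every polynomial $p$ with coefficients in $\mathbb N$ and that contains with $P$ and $Q$ also $P+Q$, $P\cdot Q$ and $(l,n)\mapsto l(P(l,n))$. A functional $F\colon A\to\mathcal B$ is *$A$-restricted polynomial-time computable* if it is computed by a machine $M$ for which there is a second-order polynomial $P$ with $\mathrm{time}_{M^\varphi}(\mathbf a)\le P(|\varphi|,|\mathbf a|)$ for all $\varphi\in A$ and $\mathbf a\in\Sigma^*$. **Strongly polynomial time.** Let $\mathbf b_k$ be the content of the answer tape after $k$ steps of the computation of $M$ with oracle $\varphi$ on input $\mathbf a$ (after termination it no longer changes), and put $o_{\varphi,\mathbf a}(0)=|\mathbf a|$ and $o_{\varphi,\mathbf a}(n+1)=\max\{o_{\varphi,\mathbf a}(n),|\mathbf b_{n+1}|\}$. The machine $M$ has *finite length-revision on $A$* if there is $N\in\mathbb N$ such that for all $\varphi\in A$ and $\mathbf a\in\Sigma^*$ the function $o_{\varphi,\mathbf a}$ takes at most $N$ values. A function $t\colon\mathbb N\to\mathbb N$ is a *step-count of $M$ on $A$* if $n\le t(o_{\varphi,\mathbf a}(n))$ for all $\varphi\in A$, $\mathbf a\in\Sigma^*$ and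 all $n\in\mathbb N$ with $n\le\mathrm{time}_{M^\varphi}(\mathbf a)$. A functional $F\colon A\to\mathcal B$ is *$A$-restricted strongly polynomial-time computable* if it is computed by a machine that has finite length-revision on $A$ and a polynomial step-count on $A$. A total functional $G\colon\mathcal B\to\mathcal B$ is *strongly polynomial-time computable* if this holds with $A=\mathcal B$. **Theorem.** Let $A\subseteq\mathcal B$ be a set of length-monotone string functions, that is, for every $\varphi\in A$ and all strings $\mathbf a,\mathbf b$ with $|\mathbf a|\le|\mathbf b|$ one has $|\varphi(\mathbf a)|\le|\varphi(\mathbf b)|$. Let $F\colon A\to\mathcal B$. Then $F$ is $A$-restricted polynomial-time computable if and only if it is $A$-restricted strongly polynomial-time computable. Moreover, $F$ is $A$-restricted polynomial-time computable if and only if it has an extension $G\colon\mathcal B\to\mathcal B$ that is strongly polynomial-time computable. -/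

import Mathlib

namespace OracleComplexity

/-- Finite binary strings. -/
abbrev Str : Type := List Bool

/-- Baire space: all string functions. -/
abbrev Baire : Type := Str → Str

/-- A string function is length-monotone if longer arguments have longer (or equally long)
values. -/
def LengthMonotone (φ : Baire) : Prop :=
  ∀ a b : Str, a.length ≤ b.length → (φ a).length ≤ (φ b).length

/-- The size function of `φ`: the maximal length of `φ a` over all strings `a` of length at
most `n`. -/
noncomputable def size (φ : Baire) (n : ℕ) : ℕ :=
  sSup {m : ℕ | ∃ a : Str, a.length ≤ n ∧ (φ a).length = m}

/-- The supremum in `size` is a maximum. -/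
theorem isGreatest_size (φ : Baire) (n : ℕ) :
    IsGreatest {m : ℕ | ∃ a : Str, a.length ≤ n ∧ (φ a).length = m} (size φ n) := by
  have hfin : {m : ℕ | ∃ a : Str, a.length ≤ n ∧ (φ a).length = m}.Finite := by
    have h := (List.finite_length_le Bool n).image (fun a : Str => (φ a).length)
    refine h.subset ?_
    rintro m ⟨a, ha, rfl⟩
    exact ⟨a, ha, rfl⟩
  have hne : {m : ℕ | ∃ a : Str, a.length ≤ n ∧ (φ a).length = m}.Nonempty :=
    ⟨(φ []).length, [], Nat.zero_le n, rfl⟩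
  exact ⟨Nat.sSup_mem hne hfin.bddAbove, fun m hm => le_csSup hfin.bddAbove hm⟩

/-- The second-order polynomials: the smallest class of functions that contains all ordinary
polynomials and is closed under sums, products and application of the function argument. -/
inductive IsSecondOrderPolynomial : ((ℕ → ℕ) → ℕ → ℕ) → Prop
  | poly (p : Polynomial ℕ) : IsSecondOrderPolynomial (fun _ n => p.eval n)
  | add {P Q : (ℕ → ℕ) → ℕ → ℕ} : IsSecondOrderPolynomial P → IsSecondOrderPolynomial Q →
      IsSecondOrderPolynomial (fun l n => P l n + Q l n)
  | mul {P Q : (ℕ → ℕ) → ℕ → ℕ} : IsSecondOrderPolynomial P → IsSecondOrderPolynomial Q →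
      IsSecondOrderPolynomial (fun l n => P l n * Q l n)
  | app {P : (ℕ → ℕ) → ℕ → ℕ} : IsSecondOrderPolynomial P →
      IsSecondOrderPolynomial (fun l n => l (P l n))

/-! ### Tapes -/

/-- A two-way infinite tape with its head position; `none` is the blank symbol. -/
structure Tape where
  cell : ℤ → Option Bool
  head : ℤ

/-- The cells of a tape that carries `w` in the cells `0, 1, …, w.length - 1` and is blank
elsewhere. -/
def cellsOf (w : Str) (i : ℤ) : Option Bool :=
  if 0 ≤ i then w[i.toNat]? else none

namespace Tape

/-- The tape carrying the string `w`, with the head on cell `0`. -/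
def ofStr (w : Str) : Tape := ⟨cellsOf w, 0⟩

/-- The symbol under the head. -/
def read (t : Tape) : Option Bool := t.cell t.head

/-- Write a symbol under the head. -/
def write (t : Tape) (s : Option Bool) : Tape :=
  ⟨fun i => if i = t.head then s else t.cell i, t.head⟩

/-- Move the head by `d` cells. -/
def move (t : Tape) (d : ℤ) : Tape := ⟨t.cell, t.head + d⟩

/-- Replace what is written on the tape by the string `w`, without moving the head. -/
def overwrite (t : Tape) (w : Str) : Tape := ⟨cellsOf w, t.head⟩

/-- The content of a tape: the string in the cells `0, 1, 2, …` up to the first blank. (On a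
tape that occurs in a computation only finitely many cells are not blank.) -/
noncomputable def content (t : Tape) : Str :=
  (List.range (sInf {n : ℕ | t.cell (n : ℤ) = none})).filterMap (fun n : ℕ => t.cell (n : ℤ))

theorem content_of_cell_eq (t : Tape) (w : Str) (h : t.cell = cellsOf w) : t.content = w := by
  have hcell : ∀ n : ℕ, t.cell (n : ℤ) = w[n]? := by
    intro n
    simp [h, cellsOf]
  have hs : sInf {n : ℕ | t.cell (n : ℤ) = none} = w.length := by
    have : {n : ℕ | t.cell (n : ℤ) = none} = Set.Ici w.length := by
      ext n
      simp [hcell]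
    rw [this, csInf_Ici]
  unfold content
  rw [hs]
  have hf : (fun n : ℕ => t.cell (n : ℤ)) = fun n : ℕ => w[n]? := funext hcell
  rw [hf]
  clear hs hcell h hf
  induction w using List.reverseRecOn with
  | nil => simp
  | append_singleton w x ih =>
    rw [List.length_append, List.length_singleton, List.range_succ, List.filterMap_append]
    congr 1
    · conv_rhs => rw [← ih]
      apply List.filterMap_congr
      intro n hn
      rw [List.getElem?_append_left (List.mem_range.1 hn)]
    · simp

end Tape

/-! ### Oracle Turing machines -/

/-- The tapes of an oracle machine: the input tape, the oracle query tape, the oracle answer tape,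
the output tape, and work tapes indexed by `K`. -/
inductive TapeName (K : Type) : Type
  | input
  | query
  | answer
  | output
  | work (k : K)

/-- A head movement. -/
inductive Dir : Type
  | left
  | stay
  | right

/-- A head movement as an offset. -/
def Dir.toInt : Dir → ℤ
  | left => -1
  | stay => 0
  | right => 1

/-- What a machine does in a given state and with given symbols under its heads: it terminates, or
asks the oracle and continues in state `next`, or performs an ordinary step (one symbol is
written on each tape, each head is moved by at most one cell, the new state is `next`). -/
inductive Instr (K Q : Type) : Type
  | halt
  | query (next : Q)
  | act (next : Q) (symbol : TapeName K → Option Bool) (dir : TapeName K → Dir)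

/-- Deterministic oracle Turing machines with finitely many work tapes and states. -/
structure OracleMachine where
  K : Type
  Q : Type
  finK : Finite K
  finQ : Finite Q
  start : Q
  program : Q → (TapeName K → Option Bool) → Instr K Q

namespace OracleMachine

/-- A configuration: the state, and the inscriptions and head positions of all tapes. -/
structure Config (M : OracleMachine) where
  state : M.Q
  tape : TapeName M.K → Tape

variable (M : OracleMachine)

/-- The initial configuration: the input is on the input tape, the other tapes are blank, all
heads are on cell `0`. -/
def init (a : Str) : M.Config where
  state := M.start
  tape
    | .input => Tape.ofStr a
    | _ => Tape.ofStr []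

/-- The effect of an ordinary step on the tapes. The answer tape is read-only. -/
def actTapes {K : Type} (T : TapeName K → Tape) (s : TapeName K → Option Bool)
    (d : TapeName K → Dir) : TapeName K → Tape
  | .answer => (T .answer).move (d .answer).toInt
  | i => ((T i).write (s i)).move (d i).toInt

/-- The effect of an oracle query on the tapes: the query `b` is removed from the query tape, and
`φ b` replaces the former content of the answer tape. No head is moved. -/
noncomputable def queryTapes {K : Type} (φ : Baire) (T : TapeName K → Tape) : TapeName K → Tape
  | .query => (T .query).overwrite []
  | .answer => (T .answer).overwrite (φ (T .query).content)
  | i => T i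

/-- One step of the computation with oracle `φ`; `none` if the machine terminates. -/
noncomputable def step (φ : Baire) (c : M.Config) : Option M.Config :=
  match M.program c.state (fun i => (c.tape i).read) with
  | .halt => none
  | .query q => some ⟨q, queryTapes φ c.tape⟩
  | .act q s d => some ⟨q, actTapes c.tape s d⟩

/-- The configuration after `n` steps with oracle `φ` on input `a`; it does not change any more
once the machine has terminated. -/
noncomputable def run (φ : Baire) (a : Str) : ℕ → M.Config
  | 0 => M.init a
  | n + 1 => (M.step φ (run φ a n)).getD (run φ a n)

/-- The computation has terminated after at most `n` steps. -/
def HaltedAt (φ : Baire) (a : Str) (n : ℕ) : Prop := M.step φ (M.run φ a n) = none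

/-- The number of steps of the computation with oracle `φ` on input `a`; it is `⊤` if the
computation diverges. -/
noncomputable def time (φ : Baire) (a : Str) : ℕ∞ :=
  sInf {t : ℕ∞ | ∃ n : ℕ, M.HaltedAt φ a n ∧ t = n}

/-- The computation with oracle `φ` on input `a` terminates with the string `w` on the output
tape. -/
def Returns (φ : Baire) (a w : Str) : Prop :=
  ∃ n : ℕ, M.HaltedAt φ a n ∧ ((M.run φ a n).tape .output).content = w

/-- The machine computes the functional `F` with domain `A`. -/
def Computes {A : Set Baire} (F : A → Baire) : Prop :=
  ∀ (φ : A) (a : Str), M.Returns φ a (F φ a)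

/-- The length revision function: the maximum of the length of the input and the lengths of the
contents of the oracle answer tape during the first `n` steps. -/
noncomputable def lengthRevision (φ : Baire) (a : Str) : ℕ → ℕ
  | 0 => a.length
  | n + 1 => max (lengthRevision φ a n) ((M.run φ a (n + 1)).tape .answer).content.length

/-- The machine has finite length-revision on oracles from `A`. -/
def FiniteLengthRevisionOn (A : Set Baire) : Prop :=
  ∃ N : ℕ, ∀ φ ∈ A, ∀ a : Str, (Set.range (M.lengthRevision φ a)).encard ≤ N

/-- The function `t` is a step-count for the machine on oracles from `A`. -/
def IsStepCountOn (A : Set Baire) (t : ℕ → ℕ) : Prop :=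
  ∀ φ ∈ A, ∀ (a : Str) (n : ℕ), (n : ℕ∞) ≤ M.time φ a → n ≤ t (M.lengthRevision φ a n)

/-- The machine runs in `A`-restricted polynomial time. -/
def RunsInPolyTimeOn (A : Set Baire) : Prop :=
  ∃ P : (ℕ → ℕ) → ℕ → ℕ, IsSecondOrderPolynomial P ∧
    ∀ φ ∈ A, ∀ a : Str, M.time φ a ≤ (P (size φ) a.length : ℕ∞)

/-- The machine runs in `A`-restricted strongly polynomial time. -/
def RunsInStrongPolyTimeOn (A : Set Baire) : Prop :=
  M.FiniteLengthRevisionOn A ∧ ∃ p : Polynomial ℕ, M.IsStepCountOn A (fun n => p.eval n)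

end OracleMachine

/-- `F : A → Baire` is `A`-restricted polynomial-time computable, that is `F ∈ P(A)`. -/
def PolyTimeComputableOn (A : Set Baire) (F : A → Baire) : Prop :=
  ∃ M : OracleMachine, M.Computes F ∧ M.RunsInPolyTimeOn A

/-- `F : A → Baire` is `A`-restricted strongly polynomial-time computable, that is
`F ∈ SP(A)`. -/
def StrongPolyTimeComputableOn (A : Set Baire) (F : A → Baire) : Prop :=
  ∃ M : OracleMachine, M.Computes F ∧ M.RunsInStrongPolyTimeOn A

/-- A total functional is strongly polynomial-time computable. -/
def StrongPolyTimeComputable (G : Baire → Baire) : Prop :=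
  StrongPolyTimeComputableOn Set.univ (fun φ => G φ)

/-- `F : A → Baire` has a total strongly polynomial-time computable extension, that is
`F ∈ SP|_A`. -/
def HasStrongPolyTimeExtension (A : Set Baire) (F : A → Baire) : Prop :=
  ∃ G : Baire → Baire, (∀ φ : A, G φ = F φ) ∧ StrongPolyTimeComputable G

end OracleComplexity

namespace OracleComplexity

/-! From strongly polynomial to polynomial time: a query asked after `n` steps has length at most
`n`, so a revision in the next step leads to a length of at most `size φ n`. The step-count `p`
bounds `n` by `p` of the previous length. With at most `N` values, iterating this estimate `N` times
bounds all lengths, hence the time, by a second-order polynomial (`revisionBound`,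
`lengthRevision_le_revisionBound`).

For the converse let `M` run in time `P` and put x₀ = |a|, xᵢ₊₁ = (xᵢ+1)² + |φ(0^((xᵢ+1)²))|; this
is `pad`. If `φ` is length-monotone, then |φ|(n) = |φ(0ⁿ)|, and induction on `P` gives a `D`,
depending only on `P`, with P(|φ|,|a|) ≤ x_D (`exists_le_pad`). For every oracle, x_D is found with
`D` queries, in time polynomial in the longest string seen so far. One more query, 0^((x_D+1)²),
yields a limit L on answer lengths. The machine `clocked` then simulates `M` until a clock of length
x_D+1 runs out, and aborts at the first answer longer than L (`good_sim`).

On an arbitrary oracle the length is thus revised at most D+2 times: D+1 times by the preparatory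
queries and once by an overlong answer. On a length-monotone oracle in `A` neither the clock nor the
limit changes the result: `M` halts within x_D steps, and the simulated queries have length at most
x_D, so their answers have length at most L (`clocked_spec`). Hence `clocked` computes a total
extension of `F`. Restricting an extension to `A` closes the circle of implications. -/

theorem size_mono (φ : Baire) : Monotone (size φ) := by
  intro m n h
  obtain ⟨a, ha, hm⟩ := (isGreatest_size φ m).1
  exact (isGreatest_size φ n).2 ⟨a, ha.trans h, hm⟩

theorem length_le_size (φ : Baire) {b : Str} {n : ℕ} (h : b.length ≤ n) :
    (φ b).length ≤ size φ n :=
  (isGreatest_size φ n).2 ⟨b, h, rfl⟩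

/-- All strings of length `n` have equally long values, so 0ⁿ attains the maximum. This makes the
size function accessible to a machine by a single query; for general oracles it is not. -/
theorem LengthMonotone.size_eq {φ : Baire} (h : LengthMonotone φ) (n : ℕ) :
    size φ n = (φ (List.replicate n false)).length := by
  refine le_antisymm ?_ (length_le_size φ (by simp))
  obtain ⟨a, ha, hm⟩ := (isGreatest_size φ n).1
  rw [← hm]
  exact h _ _ (by simpa using ha)

theorem eval_mono (p : Polynomial ℕ) : Monotone (fun n => p.eval n) := by
  intro m n h
  induction p using Polynomial.induction_on' with
  | add p q hp hq => simpa using add_le_add hp hq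
  | monomial k c => simpa using Nat.mul_le_mul_left c (Nat.pow_le_pow_left h k)

/-! ### Inscriptions and contents of tapes -/

theorem cellsOf_nonneg (w : Str) (n : ℕ) : cellsOf w n = w[n]? := by simp [cellsOf]

theorem cellsOf_eq_none {w : Str} {i : ℤ} : cellsOf w i = none ↔ i < 0 ∨ w.length ≤ i := by
  unfold cellsOf
  split_ifs with h
  · rw [List.getElem?_eq_none_iff]; omega
  · simp; omega

theorem cellsOf_isSome {w : Str} {i : ℤ} : (cellsOf w i).isSome = true ↔ 0 ≤ i ∧ i < w.length := by
  rw [Option.isSome_iff_ne_none, Ne, cellsOf_eq_none]; omega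

namespace Tape

@[ext]
theorem ext {s t : Tape} (h₁ : s.cell = t.cell) (h₂ : s.head = t.head) : s = t := by
  cases s; cases t; simp_all

theorem length_content_le {t : Tape} {n : ℕ} (h : t.cell n = none) : t.content.length ≤ n := by
  unfold content
  refine (List.length_filterMap_le _ _).trans ?_
  rw [List.length_range]
  exact Nat.sInf_le h

theorem content_congr {s t : Tape} (h : s.cell = t.cell) : s.content = t.content := by
  simp only [content, h]

@[simp] theorem content_mk (w : Str) (i : ℤ) : Tape.content ⟨cellsOf w, i⟩ = w :=
  content_of_cell_eq _ _ rfl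

@[simp] theorem content_overwrite (t : Tape) (w : Str) : (t.overwrite w).content = w :=
  content_of_cell_eq _ _ rfl

theorem write_read (t : Tape) : t.write t.read = t := by
  ext1
  · funext i
    by_cases h : i = t.head <;> simp [write, read, h]
  · rfl

/-- All cells at positions `≥ n` are blank and the head is at most `n`. -/
def BoundedBy (t : Tape) (n : ℕ) : Prop := t.head ≤ n ∧ ∀ i : ℤ, n ≤ i → t.cell i = none

theorem BoundedBy.act {t : Tape} {n : ℕ} (h : t.BoundedBy n) (s : Option Bool) (d : Dir) :
    ((t.write s).move d.toInt).BoundedBy (n + 1) := by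
  obtain ⟨h₁, h₂⟩ := h
  refine ⟨?_, fun i hi => ?_⟩
  · cases d <;> simp [move, write, Dir.toInt] <;> omega
  · push_cast at hi
    have : i ≠ t.head := by omega
    simp [move, write, this, h₂ i (by omega)]

end Tape

/-! ### From strongly polynomial time to polynomial time -/

namespace OracleMachine

variable (M : OracleMachine)

theorem run_succ_of_step {φ : Baire} {a : Str} {n : ℕ} {c : M.Config}
    (h : M.step φ (M.run φ a n) = some c) : M.run φ a (n + 1) = c := by
  simp [run, h]

theorem run_succ_of_halted {φ : Baire} {a : Str} {n : ℕ} (h : M.HaltedAt φ a n) :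
    M.run φ a (n + 1) = M.run φ a n := by
  have h' : M.step φ (M.run φ a n) = none := h
  simp [run, h']

theorem HaltedAt.run_eq {M : OracleMachine} {φ : Baire} {a : Str} {n m : ℕ}
    (h : M.HaltedAt φ a n) (hm : n ≤ m) : M.run φ a m = M.run φ a n := by
  induction m, hm using Nat.le_induction with
  | base => rfl
  | succ m hm ih =>
    rw [run_succ_of_halted, ih]
    unfold HaltedAt at *
    rwa [ih]

theorem HaltedAt.time_le {M : OracleMachine} {φ : Baire} {a : Str} {n : ℕ}
    (h : M.HaltedAt φ a n) : M.time φ a ≤ n := sInf_le ⟨n, h, rfl⟩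

theorem haltedAt_of_time_le {φ : Baire} {a : Str} {n : ℕ} (h : M.time φ a ≤ n) :
    M.HaltedAt φ a n := by
  -- For a diverging computation the infimum of the empty set is `⊤`, which the finite bound
  -- excludes.
  have hne : {t : ℕ∞ | ∃ n : ℕ, M.HaltedAt φ a n ∧ t = n}.Nonempty := by
    by_contra hne
    rw [Set.not_nonempty_iff_eq_empty] at hne
    simp [time, hne] at h
  obtain ⟨m, hm, e⟩ := csInf_mem hne
  have hmn : m ≤ n := by
    have : ((m : ℕ) : ℕ∞) ≤ n := by rw [← e]; exact h
    exact_mod_cast this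
  unfold HaltedAt at *
  rwa [HaltedAt.run_eq hm hmn]

theorem lengthRevision_mono (φ : Baire) (a : Str) : Monotone (M.lengthRevision φ a) :=
  monotone_nat_of_le_succ fun _ => le_max_left _ _

theorem length_content_answer_le (φ : Baire) (a : Str) (n : ℕ) :
    ((M.run φ a n).tape .answer).content.length ≤ M.lengthRevision φ a n := by
  cases n with
  | zero => simp [run, init, Tape.ofStr]
  | succ n => exact le_max_right _ _

/-- A step writes only under the head and moves it by at most one cell; a query blanks the tape
without moving the head. This limits the length of a query by the time at which it is asked. -/
theorem run_query_boundedBy (φ : Baire) (a : Str) (n : ℕ) :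
    ((M.run φ a n).tape .query).BoundedBy n := by
  induction n with
  | zero => exact ⟨le_rfl, fun i _ => by simp [run, init, Tape.ofStr, cellsOf]⟩
  | succ n ih =>
    rcases hs : M.step φ (M.run φ a n) with _ | c
    · rw [run_succ_of_halted _ hs]
      exact ⟨ih.1.trans (by simp), fun i hi => ih.2 i (by push_cast at hi; omega)⟩
    · rw [run_succ_of_step _ hs]
      unfold step at hs
      split at hs
      · simp at hs
      · obtain rfl := Option.some.inj hs
        exact ⟨ih.1.trans (by simp), fun i _ => by
          simp [queryTapes, Tape.overwrite, cellsOf]⟩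
      · obtain rfl := Option.some.inj hs
        exact ih.act _ _

theorem length_content_query_le (φ : Baire) (a : Str) (n : ℕ) :
    ((M.run φ a n).tape .query).content.length ≤ n :=
  Tape.length_content_le ((M.run_query_boundedBy φ a n).2 n le_rfl)

/-- One step revises the length at most to the size of the oracle at the number of steps done. -/
theorem lengthRevision_succ_le (φ : Baire) (a : Str) (n : ℕ) :
    M.lengthRevision φ a (n + 1) ≤ max (M.lengthRevision φ a n) (size φ n) := by
  refine max_le (le_max_left _ _) ?_
  have h := M.length_content_answer_le φ a n
  rcases hs : M.step φ (M.run φ a n) with _ | c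
  · rw [run_succ_of_halted _ hs]
    exact h.trans (le_max_left _ _)
  · rw [run_succ_of_step _ hs]
    unfold step at hs
    split at hs
    · simp at hs
    · obtain rfl := Option.some.inj hs
      refine le_trans ?_ (le_max_right _ _)
      simpa [queryTapes] using length_le_size φ (M.length_content_query_le φ a n)
    · obtain rfl := Option.some.inj hs
      refine le_trans ?_ (le_max_left _ _)
      rwa [Tape.content_congr (s := actTapes _ _ _ .answer) (t := (M.run φ a n).tape .answer) rfl]

/-- A bound for the `k`-th value of the length revision function. -/
def revisionBound (p : Polynomial ℕ) : ℕ → (ℕ → ℕ) → ℕ → ℕ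
  | 0, _, n => n
  | k + 1, l, n => revisionBound p k l n + l (p.eval (revisionBound p k l n))

theorem isSecondOrderPolynomial_comp (p : Polynomial ℕ) {P : (ℕ → ℕ) → ℕ → ℕ}
    (hP : IsSecondOrderPolynomial P) : IsSecondOrderPolynomial (fun l n => p.eval (P l n)) := by
  induction p using Polynomial.induction_on with
  | C c => simpa using IsSecondOrderPolynomial.poly (Polynomial.C c)
  | add p q hp hq => simpa using hp.add hq
  | monomial k c h => simpa [pow_succ, mul_assoc] using h.mul hP

theorem isSecondOrderPolynomial_revisionBound (p : Polynomial ℕ) (k : ℕ) :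
    IsSecondOrderPolynomial (revisionBound p k) := by
  induction k with
  | zero => simpa [revisionBound] using IsSecondOrderPolynomial.poly Polynomial.X
  | succ k ih => exact ih.add (isSecondOrderPolynomial_comp p ih).app

/-- After `n` steps before termination, the length revision is at most the bound for the number
of revisions so far, which is smaller than the number of values taken. -/
theorem lengthRevision_le_revisionBound {φ : Baire} {a : Str} {p : Polynomial ℕ} {n : ℕ}
    (hp : ∀ m < n, m ≤ p.eval (M.lengthRevision φ a m)) :
    ∃ k : ℕ, (k : ℕ∞) + 1 ≤ (M.lengthRevision φ a '' Set.Iic n).encard ∧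
      M.lengthRevision φ a n ≤ revisionBound p k (size φ) a.length := by
  induction n with
  | zero =>
    refine ⟨0, ?_, le_rfl⟩
    have : Set.Iic 0 = ({0} : Set ℕ) := by ext; simp
    simp [this]
  | succ n ih =>
    obtain ⟨k, hk, hb⟩ := ih fun m hm => hp m (hm.trans n.lt_succ_self)
    rcases (M.lengthRevision_mono φ a n.le_succ).eq_or_lt with h | h
    · refine ⟨k, hk.trans (Set.encard_le_encard ?_), h ▸ hb⟩
      exact Set.image_mono (Set.Iic_subset_Iic.2 n.le_succ)
    · refine ⟨k + 1, ?_, ?_⟩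
      · have hnot : M.lengthRevision φ a (n + 1) ∉ M.lengthRevision φ a '' Set.Iic n := by
          rintro ⟨m, hm, e⟩
          exact absurd (M.lengthRevision_mono φ a hm) (by rw [e]; exact not_le.2 h)
        have hsub : insert (M.lengthRevision φ a (n + 1)) (M.lengthRevision φ a '' Set.Iic n) ⊆
            M.lengthRevision φ a '' Set.Iic (n + 1) := by
          rintro _ (rfl | ⟨m, hm, rfl⟩)
          · exact ⟨n + 1, Set.mem_Iic.2 le_rfl, rfl⟩
          · exact ⟨m, le_trans hm n.le_succ, rfl⟩
        refine le_trans ?_ (Set.encard_le_encard hsub)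
        rw [Set.encard_insert_of_notMem hnot]
        push_cast
        gcongr
      · have h1 := M.lengthRevision_succ_le φ a n
        -- A strict increase can only come from the answer received in this very step.
        have h2 : M.lengthRevision φ a (n + 1) ≤ size φ n := by
          rcases le_max_iff.1 h1 with h' | h'
          · exact absurd h (not_lt.2 h')
          · exact h'
        -- The time `n` of the query is paid for by the step-count at the length before the
        -- revision.
        have h3 : size φ n ≤ size φ (p.eval (revisionBound p k (size φ) a.length)) :=
          size_mono φ ((hp n n.lt_succ_self).trans (eval_mono p hb))
        exact h2.trans (h3.trans (Nat.le_add_left _ _))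

theorem revisionBound_mono (p : Polynomial ℕ) (l : ℕ → ℕ) (n : ℕ) :
    Monotone (fun k => revisionBound p k l n) :=
  monotone_nat_of_le_succ fun _ => Nat.le_add_right _ _

/-- Strongly polynomial running time implies polynomial running time. -/
theorem RunsInStrongPolyTimeOn.runsInPolyTimeOn {M : OracleMachine} {A : Set Baire}
    (h : M.RunsInStrongPolyTimeOn A) : M.RunsInPolyTimeOn A := by
  obtain ⟨⟨N, hN⟩, p, hp⟩ := h
  refine ⟨_, isSecondOrderPolynomial_comp p (isSecondOrderPolynomial_revisionBound p N),
    fun φ hφ a => ?_⟩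
  have key : ∀ n : ℕ, (n : ℕ∞) ≤ M.time φ a →
      n ≤ p.eval (revisionBound p N (size φ) a.length) := by
    intro n hn
    obtain ⟨k, hk, hb⟩ := M.lengthRevision_le_revisionBound (φ := φ) (a := a) (p := p) (n := n)
      fun m hm => hp φ hφ a m (le_trans (by exact_mod_cast hm.le) hn)
    have hkN : k ≤ N := by
      have := (hk.trans (Set.encard_le_encard (Set.image_subset_range _ _))).trans (hN φ hφ a)
      have : k + 1 ≤ N := by exact_mod_cast this
      omega
    exact (hp φ hφ a n hn).trans (eval_mono p (hb.trans (revisionBound_mono p _ _ hkN)))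
  -- Divergence is not excluded so far, so `key` is applied one step beyond the bound and not at
  -- `time`.
  by_contra hlt
  rw [not_le] at hlt
  have := key (p.eval (revisionBound p N (size φ) a.length) + 1)
    (by exact_mod_cast Order.add_one_le_of_lt hlt)
  omega

end OracleMachine

/-! ### Silent computations and step counts -/

namespace Tape

/-- Write `w`, or nothing if `w = none`, and move the head. -/
def act (w : Option Bool) (d : Dir) (t : Tape) : Tape := (t.write (w.or t.read)).move d.toInt

@[simp] theorem act_none (d : Dir) (t : Tape) : t.act none d = ⟨t.cell, t.head + d.toInt⟩ := by
  simp [act, write_read, move]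

theorem iterate_act_none (d : Dir) (k : ℕ) (t : Tape) :
    (act none d)^[k] t = ⟨t.cell, t.head + k * d.toInt⟩ := by
  induction k with
  | zero => simp
  | succ k ih =>
    rw [Function.iterate_succ_apply', ih]
    simp
    ring

theorem act_some_end (w : Str) (b : Bool) (d : Dir) :
    (⟨cellsOf w, w.length⟩ : Tape).act (some b) d =
      ⟨cellsOf (w ++ [b]), w.length + d.toInt⟩ := by
  ext1
  · funext i
    simp only [act, move, write, Option.some_or]
    split_ifs with h
    · subst h; rw [cellsOf_nonneg]; simp
    · unfold cellsOf
      split_ifs with h'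
      · rcases lt_or_ge i.toNat w.length with h'' | h''
        · rw [List.getElem?_append_left h'']
        · rw [List.getElem?_eq_none h'', List.getElem?_eq_none]
          simp; omega
      · rfl
  · rfl

theorem iterate_act_some (y k : ℕ) (b : Bool) :
    (act (some b) .right)^[k] ⟨cellsOf (List.replicate y b), y⟩ =
      ⟨cellsOf (List.replicate (y + k) b), (y + k : ℕ)⟩ := by
  induction k with
  | zero => simp
  | succ k ih =>
    rw [Function.iterate_succ_apply', ih]
    have := act_some_end (List.replicate (y + k) b) b .right
    rw [List.length_replicate] at this
    rw [this, ← List.replicate_succ']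
    simp [Dir.toInt, add_assoc]

end Tape

/-- The instruction that writes and moves as given by `w` and `d`. -/
def Instr.go {K Q : Type} (q : Q) (w : TapeName K → Option Bool) (d : TapeName K → Dir)
    (σ : TapeName K → Option Bool) : Instr K Q :=
  .act q (fun t => (w t).or (σ t)) d

namespace OracleMachine

variable {M : OracleMachine} {φ : Baire}

/-- Writing back the symbol just read changes nothing, so the step acts on each tape separately. On
the read-only answer tape the only faithful choice is `none`. -/
theorem step_go {c : M.Config} {q : M.Q} {w d} (hw : w .answer = none)
    (h : M.program c.state (fun t => (c.tape t).read) = .go q w d (fun t => (c.tape t).read)) :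
    M.step φ c = some ⟨q, fun t => (c.tape t).act (w t) (d t)⟩ := by
  simp only [step, h, Instr.go]
  congr 2
  funext t
  cases t <;> simp [actTapes, Tape.act, hw]
  simp [Tape.write_read]

theorem step_query {c : M.Config} {q : M.Q}
    (h : M.program c.state (fun t => (c.tape t).read) = .query q) :
    M.step φ c = some ⟨q, queryTapes φ c.tape⟩ := by
  simp only [step, h]

theorem step_halt {c : M.Config}
    (h : M.program c.state (fun t => (c.tape t).read) = .halt) : M.step φ c = none := by
  simp only [step, h]

variable (φ) in
/-- `k` steps that do not change the inscription of the answer tape. -/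
inductive Silent : ℕ → M.Config → M.Config → Prop
  | refl (c) : Silent 0 c c
  | cons {k c c' c''} : M.step φ c = some c' → (c'.tape .answer).cell = (c.tape .answer).cell →
      Silent k c' c'' → Silent (k + 1) c c''

theorem Silent.trans {j k : ℕ} {c c' c'' : M.Config} (h : Silent φ j c c')
    (h' : Silent φ k c' c'') : Silent φ (j + k) c c'' := by
  induction h with
  | refl => simpa
  | cons h₁ h₂ _ ih => rw [Nat.add_right_comm]; exact .cons h₁ h₂ (ih h')

theorem Silent.cast {j k : ℕ} {c c' : M.Config} (h : Silent φ j c c') (e : j = k) :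
    Silent φ k c c' := e ▸ h

theorem Silent.answer {k : ℕ} {c c' : M.Config} (h : Silent φ k c c') :
    (c'.tape .answer).cell = (c.tape .answer).cell := by
  induction h with
  | refl => rfl
  | cons _ h₂ _ ih => exact ih.trans h₂

theorem Silent.go {q q' : M.Q} {T} {w d}
    (h : M.program q (fun t => (T t).read) = .go q' w d (fun t => (T t).read))
    (hw : w .answer = none) :
    ∃ T', Silent φ 1 ⟨q, T⟩ ⟨q', T'⟩ ∧ ∀ t, T' t = (T t).act (w t) (d t) :=
  ⟨_, .cons (step_go hw h) (by simp [hw]) (.refl _), fun _ => rfl⟩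

/-- A state that repeats one instruction iterates a fixed map on every tape; only the guard has to
be checked in each pass. The final tapes are existential, so that later arguments use them through
equations for single tapes. -/
theorem Silent.loop {q : M.Q} {w d} (k : ℕ) {T}
    (h : ∀ j < k, M.program q (fun t => ((Tape.act (w t) (d t))^[j] (T t)).read) =
      .go q w d (fun t => ((Tape.act (w t) (d t))^[j] (T t)).read))
    (hw : w .answer = none) :
    ∃ T', Silent φ k ⟨q, T⟩ ⟨q, T'⟩ ∧ ∀ t, T' t = (Tape.act (w t) (d t))^[k] (T t) := by
  refine ⟨_, ?_, fun _ => rfl⟩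
  induction k with
  | zero => exact .refl _
  | succ k ih =>
    refine (ih fun j hj => h j (hj.trans k.lt_succ_self)).trans ?_
    obtain ⟨T', h₁, h₂⟩ := Silent.go (φ := φ) (h k k.lt_succ_self) hw
    simp only [Function.iterate_succ_apply']
    rwa [funext h₂] at h₁

variable (φ) in
/-- `Good p R N v t c`: from the configuration `c`, reached after `t` steps with length revision
`v`, the computation reaches a halting configuration that satisfies `R`, with at most `N` further
length revisions and in accordance with the step-count `p`. -/
inductive Good (p : ℕ → ℕ) (R : M.Config → Prop) : ℕ → ℕ → ℕ → M.Config → Prop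
  | halt {N v t c} : M.step φ c = none → R c → t ≤ p v → Good p R N v t c
  | silent {N v t c c'} : M.step φ c = some c' → (c'.tape .answer).content.length ≤ v →
      t ≤ p v → Good p R N v (t + 1) c' → Good p R N v t c
  | revise {N v t c c'} : M.step φ c = some c' → t ≤ p v →
      Good p R N (max v (c'.tape .answer).content.length) (t + 1) c' → Good p R (N + 1) v t c

/-- Along a silent stretch `v` stays the same and the elapsed time grows, so the step-count needs
checking only at the end of the stretch. -/
theorem Good.of_silent {p : ℕ → ℕ} {R : M.Config → Prop} {N v t k : ℕ} {c c' : M.Config}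
    (h : Silent φ k c c') (hv : (c.tape .answer).content.length ≤ v) (ht : t + k ≤ p v)
    (hg : Good φ p R N v (t + k) c') : Good φ p R N v t c := by
  induction h generalizing t with
  | refl => exact hg
  | cons h₁ h₂ _ ih =>
    rw [← Tape.content_congr h₂] at hv
    refine .silent h₁ hv (by omega) (ih hv (by omega) ?_)
    rwa [Nat.add_right_comm, Nat.add_assoc]

/-- What `Good` says about a computation. -/
theorem Good.spec {p : ℕ → ℕ} {R : M.Config → Prop} {N v t : ℕ} {c : M.Config}
    (h : Good φ p R N v t c) (a : Str) (hc : M.run φ a t = c) (hv : M.lengthRevision φ a t = v) :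
    (∃ n, M.HaltedAt φ a n ∧ R (M.run φ a n)) ∧
      (∀ n, t ≤ n → (n : ℕ∞) ≤ M.time φ a → n ≤ p (M.lengthRevision φ a n)) ∧
      (M.lengthRevision φ a '' Set.Ici t).encard ≤ N + 1 := by
  induction h with
  | @halt N v t c h₁ h₂ h₃ =>
    have hH : M.HaltedAt φ a t := by rw [HaltedAt, hc]; exact h₁
    have hconst : ∀ n, t ≤ n → M.lengthRevision φ a n = v := by
      intro n hn
      induction n, hn using Nat.le_induction with
      | base => exact hv
      | succ n hn ih =>
        rw [lengthRevision, ih, hH.run_eq (hn.trans n.le_succ)]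
        have := M.length_content_answer_le φ a t
        exact max_eq_left (hv ▸ this)
    refine ⟨⟨t, hH, hc.symm ▸ h₂⟩, fun n hn hn' => ?_, ?_⟩
    · have : n ≤ t := by exact_mod_cast hn'.trans hH.time_le
      obtain rfl := le_antisymm this hn
      rwa [hv]
    · have : M.lengthRevision φ a '' Set.Ici t ⊆ {v} := by
        rintro _ ⟨n, hn, rfl⟩
        exact hconst n hn
      refine (Set.encard_le_encard this).trans ?_
      simp
  | @silent N v t c c' h₁ h₂ h₃ _ ih =>
    have hc' : M.run φ a (t + 1) = c' := run_succ_of_step _ (by rw [hc]; exact h₁)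
    have hv' : M.lengthRevision φ a (t + 1) = v := by
      rw [lengthRevision, hv, hc']
      exact max_eq_left h₂
    obtain ⟨i₁, i₂, i₃⟩ := ih hc' hv'
    refine ⟨i₁, fun n hn hn' => ?_, ?_⟩
    · rcases Nat.eq_or_lt_of_le hn with rfl | h
      · rwa [hv]
      · exact i₂ n h hn'
    · refine le_trans (Set.encard_le_encard ?_) i₃
      rintro _ ⟨n, hn, rfl⟩
      rcases Nat.eq_or_lt_of_le (Set.mem_Ici.1 hn) with rfl | h
      · exact ⟨t + 1, Set.mem_Ici.2 le_rfl, by rw [hv, hv']⟩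
      · exact ⟨n, h, rfl⟩
  | @revise N v t c c' h₁ h₃ _ ih =>
    have hc' : M.run φ a (t + 1) = c' := run_succ_of_step _ (by rw [hc]; exact h₁)
    have hv' : M.lengthRevision φ a (t + 1) = max v (c'.tape .answer).content.length := by
      rw [lengthRevision, hv, hc']
    obtain ⟨i₁, i₂, i₃⟩ := ih hc' hv'
    refine ⟨i₁, fun n hn hn' => ?_, ?_⟩
    · rcases Nat.eq_or_lt_of_le hn with rfl | h
      · rwa [hv]
      · exact i₂ n h hn'
    · refine (Set.encard_le_encard (?_ : _ ⊆ insert (M.lengthRevision φ a t)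
        (M.lengthRevision φ a '' Set.Ici (t + 1)))).trans ((Set.encard_insert_le _ _).trans ?_)
      · rintro _ ⟨n, hn, rfl⟩
        rcases Nat.eq_or_lt_of_le (Set.mem_Ici.1 hn) with rfl | h
        · exact Or.inl rfl
        · exact Or.inr ⟨n, h, rfl⟩
      · push_cast
        gcongr

end OracleMachine

/-! ### Domination of second-order polynomials -/

/-- The length of the padding after `i` stages. -/
def pad (φ : Baire) (n : ℕ) : ℕ → ℕ
  | 0 => n
  | i + 1 => (pad φ n i + 1) ^ 2 + (φ (List.replicate ((pad φ n i + 1) ^ 2) false)).length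

theorem sq_le_pad (φ : Baire) (n i : ℕ) : (pad φ n i + 1) ^ 2 ≤ pad φ n (i + 1) :=
  Nat.le_add_right _ _

theorem pad_mono (φ : Baire) (n : ℕ) : Monotone (pad φ n) :=
  monotone_nat_of_le_succ fun i => le_trans (by nlinarith) (sq_le_pad φ n i)

/-- The square in `pad` absorbs one sum or product, the oracle summand one application of the size
function. Each constructor thus costs a bounded number of stages, independently of `φ` and `n`. -/
theorem exists_le_pad {P : (ℕ → ℕ) → ℕ → ℕ} (hP : IsSecondOrderPolynomial P) :
    ∃ D, ∀ φ : Baire, LengthMonotone φ → ∀ n, P (size φ) n ≤ pad φ n D := by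
  have add {i j : ℕ} {φ : Baire} {n x y : ℕ} (hx : x ≤ pad φ n i) (hy : y ≤ pad φ n j) :
      x + y ≤ pad φ n (max i j + 1) ∧ x * y ≤ pad φ n (max i j + 1) := by
    have hx' := hx.trans (pad_mono φ n (le_max_left i j))
    have hy' := hy.trans (pad_mono φ n (le_max_right i j))
    have := sq_le_pad φ n (max i j)
    constructor <;> nlinarith
  induction hP with
  | poly p =>
    induction p using Polynomial.induction_on with
    | C c =>
      -- Each stage increases the padding by at least one, so `c` stages reach the constant `c`.
      refine ⟨c, fun φ _ n => ?_⟩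
      simp only [Polynomial.eval_C]
      induction c with
      | zero => simp
      | succ c ih =>
        have := sq_le_pad φ n c
        nlinarith
    | add p q hp hq =>
      obtain ⟨i, hi⟩ := hp
      obtain ⟨j, hj⟩ := hq
      exact ⟨max i j + 1, fun φ h n => by simpa using (add (hi φ h n) (hj φ h n)).1⟩
    | monomial k c h =>
      obtain ⟨i, hi⟩ := h
      -- The additional factor `n` is `pad φ n 0`.
      refine ⟨max i 0 + 1, fun φ h n => ?_⟩
      have := (add (j := 0) (hi φ h n) (le_refl n)).2
      simpa [pow_succ, mul_assoc] using this
  | add _ _ hp hq =>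
    obtain ⟨i, hi⟩ := hp
    obtain ⟨j, hj⟩ := hq
    exact ⟨max i j + 1, fun φ h n => (add (hi φ h n) (hj φ h n)).1⟩
  | mul _ _ hp hq =>
    obtain ⟨i, hi⟩ := hp
    obtain ⟨j, hj⟩ := hq
    exact ⟨max i j + 1, fun φ h n => (add (hi φ h n) (hj φ h n)).2⟩
  | app _ hp =>
    obtain ⟨i, hi⟩ := hp
    refine ⟨i + 1, fun φ h n => ?_⟩
    -- Only the oracle summand of the padding is needed; length-monotonicity turns it into a value
    -- of `size φ`.
    refine le_trans ?_ (Nat.le_add_left _ _)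
    rw [← h.size_eq]
    exact size_mono φ ((hi φ h n).trans (by nlinarith))

/-! ### The clocked machine -/

/-- The auxiliary work tapes of the clocked machine. -/
inductive Aux (D : ℕ) : Type
  | outer (i : Fin (D + 2))
  | inner (i : Fin (D + 2))
  | ret

/-- The states of the clocked machine. -/
inductive Phase (Q : Type) (D : ℕ) : Type
  | copy (i : Fin (D + 2))
  | back (i : Fin (D + 2))
  | rewind (i : Fin (D + 2))
  | fill (i : Fin (D + 2))
  | home (i : Fin (D + 2))
  | ask (i : Fin (D + 2))
  | sim (q : Q) (fresh : Bool)
  | check (q : Q)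
  | search (q : Q) (right : Bool)
  | resume (q : Q) (right : Bool)

instance (D : ℕ) : Finite (Aux D) := by
  refine Finite.of_surjective
    (fun x : Fin (D + 2) ⊕ Fin (D + 2) ⊕ Unit => match x with
      | .inl i => Aux.outer i
      | .inr (.inl i) => .inner i
      | .inr (.inr _) => .ret) ?_
  rintro (i | i | _)
  exacts [⟨.inl i, rfl⟩, ⟨.inr (.inl i), rfl⟩, ⟨.inr (.inr ()), rfl⟩]

instance (Q : Type) (D : ℕ) [Finite Q] : Finite (Phase Q D) := by
  refine Finite.of_surjective
    (fun x : Fin 6 × Fin (D + 2) ⊕ Fin 4 × Q × Bool => match x with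
      | .inl (0, i) => Phase.copy i
      | .inl (1, i) => .back i
      | .inl (2, i) => .rewind i
      | .inl (3, i) => .fill i
      | .inl (4, i) => .home i
      | .inl (5, i) => .ask i
      | .inr (0, q, r) => .sim q r
      | .inr (1, q, _) => .check q
      | .inr (2, q, r) => .search q r
      | .inr (3, q, r) => .resume q r) ?_
  rintro (i | i | i | i | i | i | ⟨q, r⟩ | q | ⟨q, r⟩ | ⟨q, r⟩)
  exacts [⟨.inl (0, i), rfl⟩, ⟨.inl (1, i), rfl⟩, ⟨.inl (2, i), rfl⟩, ⟨.inl (3, i), rfl⟩,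
    ⟨.inl (4, i), rfl⟩, ⟨.inl (5, i), rfl⟩, ⟨.inr (0, q, r), rfl⟩, ⟨.inr (1, q, true), rfl⟩,
    ⟨.inr (2, q, r), rfl⟩, ⟨.inr (3, q, r), rfl⟩]

section Program

variable {K Q : Type} {D : ℕ}

/-- An auxiliary tape as a tape of the clocked machine. -/
abbrev aux (x : Aux D) : TapeName (K ⊕ Aux D) := .work (.inr x)

/-- A tape of the original machine as a tape of the clocked machine. -/
def emb : TapeName K → TapeName (K ⊕ Aux D)
  | .input => .input
  | .query => .query
  | .answer => .answer
  | .output => .output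
  | .work k => .work (.inl k)

/-- The tape whose content is copied at the beginning of a stage. -/
def src (i : Fin (D + 2)) : TapeName (K ⊕ Aux D) := if i = 0 then .input else .answer

/-- The next stage. -/
def next (i : Fin (D + 2)) : Fin (D + 2) := if h : i.1 + 1 < D + 2 then ⟨i.1 + 1, h⟩ else i

/-- The stage whose inner tape serves as clock. -/
def clock (D : ℕ) : Fin (D + 2) := ⟨D, by omega⟩

/-- The state that follows the copying part of a stage. -/
def afterCopy (start : Q) (i : Fin (D + 2)) : Phase Q D :=
  if i = Fin.last (D + 1) then .sim start true else .rewind i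

/-- The symbols that the simulated machine sees. -/
def view (fresh : Bool) (σ : TapeName (K ⊕ Aux D) → Option Bool) : TapeName K → Option Bool
  | .answer => if fresh then none else σ .answer
  | t => σ (emb t)

/-- The symbols written in the simulation of an ordinary step. -/
def simSymbol (σ : TapeName (K ⊕ Aux D) → Option Bool) (s : TapeName K → Option Bool) :
    TapeName (K ⊕ Aux D) → Option Bool
  | .input => s .input
  | .query => s .query
  | .answer => none
  | .output => s .output
  | .work (.inl k) => s (.work k)
  | .work (.inr x) => σ (aux x)

/-- The head movements in the simulation of an ordinary step. -/
def simDir (d : TapeName K → Dir) : TapeName (K ⊕ Aux D) → Dir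
  | .input => d .input
  | .query => d .query
  | .answer => d .answer
  | .output => d .output
  | .work (.inl k) => d (.work k)
  | .work (.inr (.inner i)) =>
    if i = clock D then .right else if i = Fin.last (D + 1) then d .answer else .stay
  | .work (.inr _) => .stay

/-- The direction given by a truth value. -/
def side (right : Bool) : Dir := if right then .right else .left

/-- The head movements when the limit of the answer is searched for. -/
def scanDir (right : Bool) : TapeName (K ⊕ Aux D) → Dir
  | .answer => side right
  | .work (.inr (.inner i)) => if i = Fin.last (D + 1) then side right else .stay
  | .work (.inr .ret) => side right
  | _ => .stay

open Classical in
/-- The program of the clocked machine. -/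
noncomputable def clockedProgram (start : Q) (prog : Q → (TapeName K → Option Bool) → Instr K Q) :
    Phase Q D → (TapeName (K ⊕ Aux D) → Option Bool) → Instr (K ⊕ Aux D) (Phase Q D)
  | .copy i, σ =>
    if (σ (src i)).isSome then
      .go (.copy i)
        (fun t => if t = aux (.outer i) ∨ t = aux (.inner i) then some false else none)
        (fun t => if t = src i ∨ t = aux (.outer i) ∨ t = aux (.inner i) then .right else .stay) σ
    else
      .go (.back i)
        (fun t => if t = aux (.outer i) ∨ t = aux (.inner i) ∨ t = aux .ret then some true
          else none)
        (fun t => if t = src i ∨ t = aux (.inner i) then .left else .stay) σ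
  | .back i, σ =>
    if (σ (src i)).isSome then
      .go (.back i) (fun _ => none)
        (fun t => if t = src i ∨ t = aux (.inner i) then .left else .stay) σ
    else
      .go (afterCopy start i) (fun _ => none)
        (fun t => if t = src i ∨ t = aux (.inner i) then .right else .stay) σ
  | .rewind i, σ =>
    if (σ (aux (.inner i))).isSome then
      .go (.rewind i) (fun _ => none) (fun t => if t = aux (.inner i) then .left else .stay) σ
    else if (σ (aux (.outer i))).isSome then
      .go (.fill i) (fun _ => none)
        (fun t => if t = aux (.inner i) then .right else if t = aux (.outer i) then .left
          else .stay) σ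
    else
      .go (.home i) (fun _ => none)
        (fun t => if t = aux (.inner i) then .right else if t = .query then .left else .stay) σ
  | .fill i, σ =>
    if (σ (aux (.inner i))).isSome then
      .go (.fill i)
        (fun t => if t = .query ∨ t = aux (.outer (next i)) ∨ t = aux (.inner (next i)) then
          some false else none)
        (fun t => if t = aux (.inner i) ∨ t = .query ∨ t = aux (.outer (next i)) ∨
          t = aux (.inner (next i)) then .right else .stay) σ
    else
      .go (.rewind i) (fun _ => none) (fun t => if t = aux (.inner i) then .left else .stay) σ
  | .home i, σ =>
    if (σ .query).isSome then
      .go (.home i) (fun _ => none) (fun t => if t = .query then .left else .stay) σ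
    else
      .go (.ask i) (fun _ => none) (fun t => if t = .query then .right else .stay) σ
  | .ask i, _ => .query (.copy (next i))
  | .sim q fresh, σ =>
    if (σ (aux (.inner (clock D)))).isSome then
      match prog q (view fresh σ) with
      | .halt => .halt
      | .query q' => .query (.check q')
      | .act q' s d => .act (.sim q' fresh) (simSymbol σ s) (simDir d)
    else .halt
  | .check q, σ =>
    .go (.search q (σ (aux (.inner (Fin.last (D + 1))))).isSome) (fun _ => none)
      (fun t => if t = aux (.inner (clock D)) then .right else .stay) σ
  | .search q r, σ =>
    if σ (aux (.inner (Fin.last (D + 1)))) = some true then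
      if (σ .answer).isSome then .halt
      else .go (.resume q !r) (fun _ => none) (fun _ => .stay) σ
    else .go (.search q r) (fun _ => none) (scanDir r) σ
  | .resume q r, σ =>
    if (σ (aux .ret)).isSome then .go (.sim q false) (fun _ => none) (fun _ => .stay) σ
    else .go (.resume q r) (fun _ => none) (scanDir r) σ

end Program

/-! ### The clocked machine and the loops of one stage -/

namespace OracleMachine

variable (M : OracleMachine) (D : ℕ)

/-- The machine that computes a time bound by means of `D + 1` oracle queries and simulates `M`
within this bound, as long as the oracle answers do not get longer. -/
noncomputable abbrev clocked : OracleMachine where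
  K := M.K ⊕ Aux D
  Q := Phase M.Q D
  finK := by have := M.finK; infer_instance
  finQ := by have := M.finQ; infer_instance
  start := .copy 0
  program := clockedProgram M.start M.program

variable {M D} {φ : Baire}

theorem src_ne_aux {K : Type} (i : Fin (D + 2)) (x : Aux D) :
    (src i : TapeName (K ⊕ Aux D)) ≠ aux x := by
  unfold src; split_ifs <;> simp

/-- The tape with inscription `0^y` and the head behind it. -/
def zerosEnd (y : ℕ) : Tape := ⟨cellsOf (List.replicate y false), y⟩

/-- The string `0^y1`. -/
def marked (y : ℕ) : Str := List.replicate y false ++ [true]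

@[simp] theorem length_marked (y : ℕ) : (marked y).length = y + 1 := by simp [marked]

theorem act_zerosEnd (y : ℕ) (d : Dir) :
    (zerosEnd y).act (some true) d = ⟨cellsOf (marked y), y + d.toInt⟩ := by
  simpa [zerosEnd, marked] using Tape.act_some_end (List.replicate y false) true d

theorem iterate_act_zerosEnd (y k : ℕ) :
    (Tape.act (some false) .right)^[k] (zerosEnd y) = zerosEnd (y + k) :=
  Tape.iterate_act_some y k false

theorem iterate_act_stay (k : ℕ) (t : Tape) : (Tape.act none .stay)^[k] t = t := by
  simp [Tape.iterate_act_none, Dir.toInt]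

theorem act_stay (t : Tape) : t.act none .stay = t := by
  simp [Dir.toInt]

/-- The copying part of a stage. -/
theorem silent_copy {i : Fin (D + 2)} {w : Str} {y : ℕ} {T : TapeName (M.K ⊕ Aux D) → Tape}
    (hs : T (src i) = Tape.ofStr w) (ho : T (aux (.outer i)) = zerosEnd y)
    (hi : T (aux (.inner i)) = zerosEnd y)
    (hr : T (aux .ret) = Tape.ofStr [] ∨ T (aux .ret) = Tape.ofStr [true]) :
    ∃ T', Silent (M := M.clocked D) φ (2 * w.length + 2) ⟨.copy i, T⟩
        ⟨afterCopy M.start i, T'⟩ ∧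
      T' (src i) = Tape.ofStr w ∧
      T' (aux (.outer i)) = ⟨cellsOf (marked (y + w.length)), (y + w.length : ℕ)⟩ ∧
      T' (aux (.inner i)) = ⟨cellsOf (marked (y + w.length)), y⟩ ∧
      T' (aux .ret) = Tape.ofStr [true] ∧
      ∀ t, t ≠ src i → t ≠ aux (.outer i) → t ≠ aux (.inner i) → t ≠ aux .ret → T' t = T t := by
  have n1 : ∀ x : Aux D, (aux x : TapeName (M.K ⊕ Aux D)) ≠ src i := fun x => (src_ne_aux i x).symm
  have n2 := fun x : Aux D => src_ne_aux (K := M.K) i x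
  obtain ⟨T1, h1, e1⟩ := Silent.loop (M := M.clocked D) (φ := φ) (q := .copy i) (T := T) w.length
    (fun j hj => if_pos (by
      simp [n2, hs, Tape.iterate_act_none, Tape.read, Tape.ofStr, cellsOf_isSome, Dir.toInt,
        hj])) (by simp)
  have s1 : T1 (src i) = ⟨cellsOf w, w.length⟩ := by
    simp [e1, n2, hs, Tape.iterate_act_none, Tape.ofStr, Dir.toInt]
  have o1 : T1 (aux (.outer i)) = zerosEnd (y + w.length) := by
    simp [e1, ho, iterate_act_zerosEnd]
  have i1 : T1 (aux (.inner i)) = zerosEnd (y + w.length) := by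
    simp [e1, hi, iterate_act_zerosEnd]
  have f1 : ∀ t, t ≠ src i → t ≠ aux (.outer i) → t ≠ aux (.inner i) → T1 t = T t := by
    intro t a b c
    simp [e1, a, b, c, iterate_act_stay]
  obtain ⟨T2, h2, e2⟩ := Silent.go (M := M.clocked D) (φ := φ) (q := .copy i) (T := T1)
    (if_neg (by simp [s1, Tape.read, cellsOf_eq_none])) (by simp)
  have s2 : T2 (src i) = ⟨cellsOf w, w.length - 1⟩ := by
    simp [e2, n2, s1, Dir.toInt]; rfl
  have o2 : T2 (aux (.outer i)) = ⟨cellsOf (marked (y + w.length)), (y + w.length : ℕ)⟩ := by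
    simp [e2, n1, o1, act_zerosEnd, Dir.toInt]
  have i2 : T2 (aux (.inner i)) = ⟨cellsOf (marked (y + w.length)), (y + w.length : ℕ) - 1⟩ := by
    simp [e2, i1, act_zerosEnd, Dir.toInt]; rfl
  -- Every stage writes the mark on the return tape; after the first stage this rewrites the same
  -- symbol.
  have r2 : T2 (aux .ret) = Tape.ofStr [true] := by
    have : T1 (aux .ret) = T (aux .ret) := f1 _ (n1 _) (by simp) (by simp)
    simp only [e2, this, n1, reduceCtorEq, TapeName.work.injEq, Sum.inr.injEq, or_false, if_true,
      if_false, or_true]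
    rcases hr with h | h <;> rw [h]
    · simpa [Tape.ofStr, Dir.toInt] using Tape.act_some_end [] true .stay
    · ext1
      · funext j
        simp only [Tape.act, Tape.move, Tape.write, Tape.ofStr, Option.some_or]
        by_cases hj : j = 0
        · subst hj; rfl
        · exact if_neg hj
      · rfl
  have f2 : ∀ t, t ≠ src i → t ≠ aux (.outer i) → t ≠ aux (.inner i) → t ≠ aux .ret →
      T2 t = T t := by
    intro t a b c d
    rw [← f1 t a b c]
    simp [e2, a, b, c, d, Dir.toInt]
  -- The inner head goes back together with the source head and therefore ends at cell `y`, aligned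
  -- with cell `0` of the source. In the last stage this alignment is what ties the limit to the
  -- answer tape.
  obtain ⟨T3, h3, e3⟩ := Silent.loop (M := M.clocked D) (φ := φ) (q := .back i) (T := T2) w.length
    (fun j hj => if_pos (by
      simp [s2, Tape.read, Tape.iterate_act_none, cellsOf_isSome, Dir.toInt]
      omega)) (by simp)
  obtain ⟨T4, h4, e4⟩ := Silent.go (M := M.clocked D) (φ := φ) (q := .back i) (T := T3)
    (if_neg (by simp [e3, s2, Tape.read, Tape.iterate_act_none, cellsOf_eq_none, Dir.toInt]))
    (by simp)
  refine ⟨T4, (((h1.trans h2).trans h3).trans h4).cast (by omega), ?_, ?_, ?_, ?_, ?_⟩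
  · simp [e4, e3, s2, Tape.iterate_act_none, Dir.toInt, Tape.ofStr]
    ring
  · simp [e4, e3, o2, Tape.iterate_act_none, Dir.toInt, n1]
  · simp [e4, e3, i2, Tape.iterate_act_none, Dir.toInt]
    ring
  · simp [e4, e3, r2, Tape.iterate_act_none, Dir.toInt, n1]
  · intro t a b c d
    simp [e4, e3, a, c, f2 t a b c d, iterate_act_stay, Dir.toInt]

theorem silent_rewind {i : Fin (D + 2)} {b : Str} {m : ℕ} (hm : m ≤ b.length)
    {T : TapeName (M.K ⊕ Aux D) → Tape} (hi : T (aux (.inner i)) = ⟨cellsOf b, m - 1⟩) :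
    ∃ T', Silent (M := M.clocked D) φ m ⟨.rewind i, T⟩ ⟨.rewind i, T'⟩ ∧
      T' (aux (.inner i)) = ⟨cellsOf b, -1⟩ ∧
      ∀ t, t ≠ aux (.inner i) → T' t = T t := by
  obtain ⟨T1, h1, e1⟩ := Silent.loop (M := M.clocked D) (φ := φ) (q := .rewind i) (T := T) m
    (fun j hj => if_pos (by
      simp [hi, Tape.read, Tape.iterate_act_none, cellsOf_isSome, Dir.toInt]
      omega)) (by simp)
  refine ⟨T1, h1, ?_, fun t h => ?_⟩
  · simp [e1, hi, Tape.iterate_act_none, Dir.toInt]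
    ring
  · simp [e1, h, iterate_act_stay]

/-- One pass of the inner loop. The zeros go to the query tape and at the same time to both tapes of
the next stage, which thereby receive the square before the answer is appended to them. -/
theorem silent_fill {i : Fin (D + 2)} (hne : next i ≠ i) {b : Str} {k : ℕ}
    {T : TapeName (M.K ⊕ Aux D) → Tape} (hi : T (aux (.inner i)) = ⟨cellsOf b, 0⟩)
    (hq : T .query = zerosEnd k) (ho : T (aux (.outer (next i))) = zerosEnd k)
    (hn : T (aux (.inner (next i))) = zerosEnd k) :
    ∃ T', Silent (M := M.clocked D) φ (b.length + 1) ⟨.fill i, T⟩ ⟨.rewind i, T'⟩ ∧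
      T' (aux (.inner i)) = ⟨cellsOf b, b.length - 1⟩ ∧
      T' .query = zerosEnd (k + b.length) ∧
      T' (aux (.outer (next i))) = zerosEnd (k + b.length) ∧
      T' (aux (.inner (next i))) = zerosEnd (k + b.length) ∧
      ∀ t, t ≠ aux (.inner i) → t ≠ .query → t ≠ aux (.outer (next i)) →
        t ≠ aux (.inner (next i)) → T' t = T t := by
  obtain ⟨T1, h1, e1⟩ := Silent.loop (M := M.clocked D) (φ := φ) (q := .fill i) (T := T) b.length
    (fun j hj => if_pos (by
      simp [hi, hne.symm, Tape.read, Tape.iterate_act_none, cellsOf_isSome, Dir.toInt, hj]))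
    (by simp)
  obtain ⟨T2, h2, e2⟩ := Silent.go (M := M.clocked D) (φ := φ) (q := .fill i) (T := T1)
    (if_neg (by
      simp [e1, hi, hne.symm, Tape.read, Tape.iterate_act_none, cellsOf_eq_none, Dir.toInt]))
    (by simp)
  refine ⟨T2, h1.trans h2, ?_, ?_, ?_, ?_, fun t a b c d => ?_⟩
  · simp [e2, e1, hi, hne.symm, Tape.iterate_act_none, Dir.toInt]
    rfl
  · simp [e2, e1, hq, iterate_act_zerosEnd, Dir.toInt]
  · simp [e2, e1, ho, iterate_act_zerosEnd, Dir.toInt]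
  · simp [e2, e1, hn, hne, iterate_act_zerosEnd, Dir.toInt]
  · simp [e2, e1, a, b, c, d, iterate_act_stay, Dir.toInt]

/-- The nested loop of a stage, with `m` passes to go. -/
theorem silent_square {i : Fin (D + 2)} (hne : next i ≠ i) {b b' : Str} {m p k : ℕ}
    (hm : m ≤ b.length) (hp : p ≤ b'.length) {T : TapeName (M.K ⊕ Aux D) → Tape}
    (hu : T (aux (.outer i)) = ⟨cellsOf b, m - 1⟩)
    (hi : T (aux (.inner i)) = ⟨cellsOf b', p - 1⟩)
    (hq : T .query = zerosEnd k) (ho : T (aux (.outer (next i))) = zerosEnd k)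
    (hn : T (aux (.inner (next i))) = zerosEnd k) :
    ∃ T', Silent (M := M.clocked D) φ (p + 1 + m * (2 * b'.length + 2)) ⟨.rewind i, T⟩
        ⟨.home i, T'⟩ ∧
      T' (aux (.inner i)) = ⟨cellsOf b', 0⟩ ∧
      T' .query = ⟨cellsOf (List.replicate (k + m * b'.length) false),
        (k + m * b'.length : ℕ) - 1⟩ ∧
      T' (aux (.outer (next i))) = zerosEnd (k + m * b'.length) ∧
      T' (aux (.inner (next i))) = zerosEnd (k + m * b'.length) ∧
      ∀ t, t ≠ aux (.outer i) → t ≠ aux (.inner i) → t ≠ .query → t ≠ aux (.outer (next i)) →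
        t ≠ aux (.inner (next i)) → T' t = T t := by
  induction m generalizing p k T with
  | zero =>
    obtain ⟨T1, h1, i1, f1⟩ := silent_rewind (φ := φ) hp hi
    have u1 : T1 (aux (.outer i)) = ⟨cellsOf b, -1⟩ := by rw [f1 _ (by simp), hu]; simp
    obtain ⟨T2, h2, e2⟩ := Silent.go (M := M.clocked D) (φ := φ) (q := .rewind i) (T := T1)
      ((if_neg (by simp [i1, Tape.read, cellsOf_eq_none])).trans
        (if_neg (by simp [u1, Tape.read, cellsOf_eq_none])))
      (by simp)
    refine ⟨T2, (h1.trans h2).cast (by simp), ?_, ?_, ?_, ?_, fun t a b c d e => ?_⟩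
    · simp [e2, i1, Dir.toInt]
    · simp [e2, f1, hq, Dir.toInt, zerosEnd]; rfl
    · simp [e2, f1, ho, Dir.toInt]
    · simp [e2, f1, hn, hne, Dir.toInt]
    · simp [e2, f1, b, c, Dir.toInt]
  | succ m ih =>
    obtain ⟨T1, h1, i1, f1⟩ := silent_rewind (φ := φ) hp hi
    have u1 : T1 (aux (.outer i)) = ⟨cellsOf b, m⟩ := by rw [f1 _ (by simp), hu]; simp
    obtain ⟨T2, h2, e2⟩ := Silent.go (M := M.clocked D) (φ := φ) (q := .rewind i) (T := T1)
      ((if_neg (by simp [i1, Tape.read, cellsOf_eq_none])).trans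
        (if_pos (by simp [u1, Tape.read, cellsOf_isSome]; omega)))
      (by simp)
    obtain ⟨T3, h3, i3, q3, o3, n3, f3⟩ := silent_fill (φ := φ) (M := M) hne (b := b') (k := k)
      (T := T2) (by simp [e2, i1, Dir.toInt]) (by simp [e2, f1, hq, Dir.toInt])
      (by simp [e2, f1, ho, hne, Dir.toInt]) (by simp [e2, f1, hn, hne, Dir.toInt])
    have u3 : T3 (aux (.outer i)) = ⟨cellsOf b, m - 1⟩ := by
      rw [f3 _ (by simp) (by simp) (by simp [hne.symm]) (by simp)]
      simp [e2, u1, Dir.toInt]; rfl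
    -- Only the first pass may start inside the inner tape; all later ones start at its right end,
    -- which is why `p` varies in the induction.
    obtain ⟨T4, h4, i4, q4, o4, n4, f4⟩ := ih (by omega) le_rfl u3 i3 q3 o3 n3
    have e : k + b'.length + m * b'.length = k + (m + 1) * b'.length := by ring
    rw [e] at q4 o4 n4
    refine ⟨T4, (((h1.trans h2).trans h3).trans h4).cast (by ring), i4, q4, o4, n4,
      fun t a b c d e => ?_⟩
    rw [f4 t a b c d e, f3 t b c d e, e2, f1 t b]
    simp [a, b, Dir.toInt]

theorem silent_home {i : Fin (D + 2)} {b : Str} {T : TapeName (M.K ⊕ Aux D) → Tape}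
    (hq : T .query = ⟨cellsOf b, b.length - 1⟩) :
    ∃ T', Silent (M := M.clocked D) φ (b.length + 1) ⟨.home i, T⟩ ⟨.ask i, T'⟩ ∧
      T' .query = Tape.ofStr b ∧ ∀ t, t ≠ .query → T' t = T t := by
  obtain ⟨T1, h1, e1⟩ := Silent.loop (M := M.clocked D) (φ := φ) (q := .home i) (T := T) b.length
    (fun j hj => if_pos (by
      simp [hq, Tape.read, Tape.iterate_act_none, cellsOf_isSome, Dir.toInt]
      omega)) (by simp)
  obtain ⟨T2, h2, e2⟩ := Silent.go (M := M.clocked D) (φ := φ) (q := .home i) (T := T1)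
    (if_neg (by simp [e1, hq, Tape.read, Tape.iterate_act_none, cellsOf_eq_none, Dir.toInt]))
    (by simp)
  refine ⟨T2, h1.trans h2, ?_, fun t a => ?_⟩
  · simp [e2, e1, hq, Tape.iterate_act_none, Dir.toInt, Tape.ofStr]
    ring
  · simp [e2, e1, a, iterate_act_stay, Dir.toInt]

end OracleMachine

/-! ### The invariant between stages -/

/-- The number of zeros that precede the copied string in stage `i`. -/
def stem (φ : Baire) (n : ℕ) : ℕ → ℕ
  | 0 => 0
  | i + 1 => (pad φ n i + 1) ^ 2

/-- The oracle answer at the beginning of stage `i`. -/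
def reply (φ : Baire) (n : ℕ) : ℕ → Str
  | 0 => []
  | i + 1 => φ (List.replicate ((pad φ n i + 1) ^ 2) false)

theorem stem_le_pad (φ : Baire) (n i : ℕ) : stem φ n i ≤ pad φ n i := by
  cases i with
  | zero => exact Nat.zero_le _
  | succ i => exact Nat.le_add_right _ _

namespace OracleMachine

variable {M : OracleMachine} {D : ℕ} {φ : Baire}

variable (M D φ) in
/-- The tapes of the clocked machine after the copying part of stage `j`. -/
structure Ready (a : Str) (j : ℕ) (T : TapeName (M.K ⊕ Aux D) → Tape) : Prop where
  input : T .input = Tape.ofStr a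
  query : T .query = Tape.ofStr []
  answer : T .answer = Tape.ofStr (reply φ a.length j)
  output : T .output = Tape.ofStr []
  work : ∀ k, T (.work (.inl k)) = Tape.ofStr []
  ret : T (aux .ret) = Tape.ofStr [true]
  outer : ∀ i : Fin (D + 2), i.1 = j →
    T (aux (.outer i)) = ⟨cellsOf (marked (pad φ a.length j)), pad φ a.length j⟩
  inner : ∀ i : Fin (D + 2), i.1 = j →
    T (aux (.inner i)) = ⟨cellsOf (marked (pad φ a.length j)), stem φ a.length j⟩
  later : ∀ i : Fin (D + 2), j < i.1 →
    T (aux (.outer i)) = Tape.ofStr [] ∧ T (aux (.inner i)) = Tape.ofStr []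
  prev : ∀ i : Fin (D + 2), i.1 + 1 = j →
    T (aux (.inner i)) = ⟨cellsOf (marked (pad φ a.length i.1)), 0⟩

theorem silent_init (a : Str) :
    ∃ T, Silent φ (2 * a.length + 2) ((M.clocked D).init a) ⟨afterCopy M.start 0, T⟩ ∧
      Ready M D φ a 0 T := by
  obtain ⟨T, h, hs, hu, hi, hr, hf⟩ := silent_copy (M := M) (D := D) (φ := φ) (i := 0) (w := a)
    (y := 0) (T := ((M.clocked D).init a).tape) rfl rfl rfl (Or.inl rfl)
  refine ⟨T, h, hs, ?_, ?_, ?_, fun k => ?_, hr, fun i hi0 => ?_, fun i hi0 => ?_,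
    fun i h0 => ?_, fun i h0 => by omega⟩
  · rw [hf _ (by simp [src]) (by simp) (by simp) (by simp)]; rfl
  · rw [hf _ (by simp [src]) (by simp) (by simp) (by simp)]; rfl
  · rw [hf _ (by simp [src]) (by simp) (by simp) (by simp)]; rfl
  · rw [hf _ (by simp [src]) (by simp) (by simp) (by simp)]; rfl
  · obtain rfl : i = 0 := Fin.ext hi0
    simpa [pad] using hu
  · obtain rfl : i = 0 := Fin.ext hi0
    simpa [pad, stem] using hi
  · have : i ≠ 0 := fun e => by simp [e] at h0
    rw [hf _ (by simp [src]) (by simp [this]) (by simp) (by simp),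
      hf _ (by simp [src]) (by simp) (by simp [this]) (by simp)]
    exact ⟨rfl, rfl⟩

/-- A stage consists of a silent computation, an oracle query and another silent computation. -/
theorem silent_stage {a : Str} {j : ℕ} {i : Fin (D + 2)} (hj : i.1 = j) (hD : j + 1 < D + 2)
    {T : TapeName (M.K ⊕ Aux D) → Tape} (hT : Ready M D φ a j T) :
    ∃ s c c' T', s ≤ 4 * (pad φ a.length j + 2) ^ 2 ∧
      Silent (M := M.clocked D) φ s ⟨.rewind i, T⟩ c ∧
      (M.clocked D).step φ c = some c' ∧
      (c'.tape .answer).content = reply φ a.length (j + 1) ∧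
      Silent φ (2 * (reply φ a.length (j + 1)).length + 2) c' ⟨afterCopy M.start (next i), T'⟩ ∧
      Ready M D φ a (j + 1) T' := by
  have hi' : (next i).1 = j + 1 := by simp [next, hj, hD]
  have hne : next i ≠ i := fun e => by rw [e] at hi'; omega
  have h0 : next i ≠ 0 := fun e => by simp [e] at hi'
  set x := pad φ a.length j with hx
  obtain ⟨hu', hi''⟩ := hT.later (next i) (by omega)
  -- The heads stand at `m - 1` and `p - 1`: the outer one on the end mark, the inner one just
  -- behind the stem. Counting the mark, both tapes carry `x + 1` symbols, which produces the square
  -- of `x + 1`.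
  obtain ⟨T1, h1, i1, q1, u1, n1, f1⟩ := silent_square (φ := φ) (M := M) hne (b := marked x)
    (b' := marked x) (m := x + 1) (p := stem φ a.length j + 1) (k := 0) (T := T)
    (by simp) (by simpa using stem_le_pad φ a.length j)
    (by rw [hT.outer i hj]; simp [hx]) (by rw [hT.inner i hj]; simp [hx]) hT.query hu' hi''
  simp only [length_marked, zero_add, ← pow_two] at q1 u1 n1
  obtain ⟨T2, h2, q2, f2⟩ := silent_home (φ := φ) (M := M) (i := i)
    (b := List.replicate ((x + 1) ^ 2) false) (T := T1) (by simpa using q1)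
  set y := (x + 1) ^ 2 with hy
  have hrep : reply φ a.length (j + 1) = φ (List.replicate y false) := rfl
  have hsrc : (src (next i) : TapeName (M.K ⊕ Aux D)) = .answer := by simp [src, h0]
  have hfr : ∀ t, t ≠ aux (.outer i) → t ≠ aux (.inner i) → t ≠ .query →
      t ≠ aux (.outer (next i)) → t ≠ aux (.inner (next i)) → t ≠ .answer →
      queryTapes φ T2 t = T t := by
    intro t a b c d e f
    rw [← f1 t a b c d e, ← f2 t c]
    cases t <;> first | rfl | contradiction
  have ha : queryTapes φ T2 .answer = Tape.ofStr (reply φ a.length (j + 1)) := by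
    have e1 : T2 .answer = Tape.ofStr (reply φ a.length j) := by
      rw [f2 _ (by simp), f1 _ (by simp) (by simp) (by simp) (by simp) (by simp), hT.answer]
    simp only [queryTapes, e1, q2, hrep]
    simp [Tape.ofStr, Tape.overwrite]
  have hq : queryTapes φ T2 .query = Tape.ofStr [] := by
    simp only [queryTapes, q2]
    simp [Tape.ofStr, Tape.overwrite]
  have hi3 : queryTapes φ T2 (aux (.inner i)) = ⟨cellsOf (marked x), 0⟩ := by
    rw [← i1, ← f2 _ (by simp)]; rfl
  have hu4 : queryTapes φ T2 (aux (.outer (next i))) = zerosEnd y := by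
    rw [← u1, ← f2 _ (by simp)]; rfl
  have hi4 : queryTapes φ T2 (aux (.inner (next i))) = zerosEnd y := by
    rw [← n1, ← f2 _ (by simp)]; rfl
  obtain ⟨T3, h3, s3, u3, i3, r3, f3⟩ := silent_copy (M := M) (D := D) (φ := φ) (i := next i)
    (w := reply φ a.length (j + 1)) (y := y) (T := queryTapes φ T2) (by rw [hsrc, ha]) hu4 hi4
    (Or.inr (by
      rw [hfr _ (by simp) (by simp) (by simp) (by simp) (by simp) (by simp), hT.ret]))
  rw [hsrc] at s3 f3
  refine ⟨_, _, _, T3, ?_, h1.trans h2, step_query rfl, ?_, h3, ?_⟩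
  · simp only [length_marked, List.length_replicate]
    have := stem_le_pad φ a.length j
    rw [hy]
    nlinarith
  · exact (congrArg Tape.content ha).trans (by simp [Tape.ofStr])
  · have hpad : pad φ a.length (j + 1) = y + (reply φ a.length (j + 1)).length := rfl
    refine ⟨?_, ?_, s3, ?_, fun k => ?_, r3, fun l hl => ?_, fun l hl => ?_, fun l hl => ?_,
      fun l hl => ?_⟩
    · rw [f3 _ (by simp) (by simp) (by simp) (by simp),
        hfr _ (by simp) (by simp) (by simp) (by simp) (by simp) (by simp), hT.input]
    · rw [f3 _ (by simp) (by simp) (by simp) (by simp), hq]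
    · rw [f3 _ (by simp) (by simp) (by simp) (by simp),
        hfr _ (by simp) (by simp) (by simp) (by simp) (by simp) (by simp), hT.output]
    · rw [f3 _ (by simp) (by simp) (by simp) (by simp),
        hfr _ (by simp) (by simp) (by simp) (by simp) (by simp) (by simp), hT.work]
    · obtain rfl : l = next i := Fin.ext (hl.trans hi'.symm)
      rw [u3, hpad]
    · obtain rfl : l = next i := Fin.ext (hl.trans hi'.symm)
      rw [i3, hpad]; rfl
    · have a1 : l ≠ next i := fun e => by rw [e] at hl; omega
      have a2 : l ≠ i := fun e => by rw [e] at hl; omega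
      obtain ⟨b1, b2⟩ := hT.later l (by omega)
      constructor
      · rw [f3 _ (by simp) (by simp [a1]) (by simp) (by simp),
          hfr _ (by simp [a2]) (by simp) (by simp) (by simp [a1]) (by simp) (by simp), b1]
      · rw [f3 _ (by simp) (by simp) (by simp [a1]) (by simp),
          hfr _ (by simp) (by simp [a2]) (by simp) (by simp) (by simp [a1]) (by simp), b2]
    · obtain rfl : l = i := Fin.ext (by omega)
      rw [f3 _ (by simp) (by simp) (by simp [hne.symm]) (by simp), hi3, hx, hj]

end OracleMachine

/-! ### Simulation with a clock and a limit on answers -/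

theorem clock_ne_last (D : ℕ) : clock D ≠ Fin.last (D + 1) := by
  simp [clock, Fin.ext_iff]

namespace OracleMachine

theorem cellsOf_marked {m : ℕ} {i : ℤ} : cellsOf (marked m) i = some true ↔ i = m := by
  unfold cellsOf
  split_ifs with h
  · rw [marked, List.getElem?_append]
    split_ifs with h'
    · rw [List.length_replicate] at h'
      simp [h']
      omega
    · rw [List.length_replicate, not_lt] at h'
      rw [List.length_replicate]
      rcases Nat.eq_zero_or_pos (i.toNat - m) with h0 | h0
      · simp [h0]; omega
      · rw [List.getElem?_eq_none (by simp; omega)]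
        simp; omega
  · simp; omega

variable {M : OracleMachine} {D : ℕ} {φ : Baire}

variable (M D φ) in
/-- The tapes of the clocked machine while it simulates the configuration `c` of the original
machine, after `n` simulated steps. -/
structure Sim (a : Str) (n : ℕ) (c : M.Config) (fresh : Bool)
    (T : TapeName (M.K ⊕ Aux D) → Tape) : Prop where
  other : ∀ t, t ≠ .answer → T (emb t) = c.tape t
  head : (T .answer).head = (c.tape .answer).head
  cell : (c.tape .answer).cell = if fresh then cellsOf [] else (T .answer).cell
  short : (T .answer).content.length ≤ (reply φ a.length (D + 1)).length
  clock : T (aux (.inner (clock D))) = ⟨cellsOf (marked (pad φ a.length D)), n⟩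
  scan : T (aux (.inner (Fin.last (D + 1)))) = ⟨cellsOf (marked (pad φ a.length (D + 1))),
    stem φ a.length (D + 1) + (c.tape .answer).head⟩
  ret : T (aux .ret) = Tape.ofStr [true]
  head_le : |(c.tape .answer).head| ≤ n

/-- Before the first simulated query the answer tape still holds the reply of the last stage. It is
read-only and cannot be erased, so the flag `fresh` makes it look blank. -/
theorem Sim.view_eq {a : Str} {n : ℕ} {c : M.Config} {fresh : Bool}
    {T : TapeName (M.K ⊕ Aux D) → Tape} (h : Sim M D φ a n c fresh T) :
    view fresh (fun t => (T t).read) = fun t => (c.tape t).read := by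
  funext t
  cases t
  case answer =>
    simp only [view, Tape.read, h.cell, h.head]
    cases fresh <;> simp [cellsOf]
  all_goals
    rw [← h.other _ (by simp)]
    rfl

/-- The clock head advances by one cell and the head on the last inner tape copies the move of the
answer head, so their offsets persist. -/
theorem Sim.act {a : Str} {n : ℕ} {c : M.Config} {fresh : Bool}
    {T : TapeName (M.K ⊕ Aux D) → Tape} (h : Sim M D φ a n c fresh T) (q s d) :
    Sim M D φ a (n + 1) ⟨q, actTapes c.tape s d⟩ fresh
      (actTapes T (simSymbol (fun t => (T t).read) s) (simDir d)) := by
  refine ⟨fun t ht => ?_, ?_, h.cell, h.short, ?_, ?_, ?_, ?_⟩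
  · have := h.other t ht
    cases t <;> first | exact absurd rfl ht | simp [actTapes, emb, simSymbol, simDir, ← this]
  · simp [actTapes, Tape.move, h.head, simDir]
  · simp only [actTapes, simSymbol, simDir, Tape.write_read, if_true, h.clock]
    simp [Tape.move, Dir.toInt]
  · simp only [actTapes, simSymbol, simDir, Tape.write_read, if_neg (clock_ne_last D).symm,
      if_true, h.scan]
    simp [Tape.move, add_assoc]
  · simp only [actTapes, simSymbol, simDir, Tape.write_read, h.ret]
    simp [Tape.move, Dir.toInt]
  · have := h.head_le
    simp only [actTapes, Tape.move]
    rw [abs_le] at this ⊢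
    push_cast
    cases d .answer <;> simp only [Dir.toInt] <;> constructor <;> omega

/-- The position of the answer head is moved to the limit. -/
theorem silent_search {q : M.Q} {r : Bool} {k : ℕ} {m : ℕ} {x h z : ℤ} {w : Str}
    {T : TapeName (M.K ⊕ Aux D) → Tape} (ha : T .answer = ⟨cellsOf w, h⟩)
    (hs : T (aux (.inner (Fin.last (D + 1)))) = ⟨cellsOf (marked m), x⟩)
    (hr : T (aux .ret) = ⟨cellsOf [true], z⟩) (hk : x + k * (side r).toInt = m) :
    ∃ T', Silent (M := M.clocked D) φ k ⟨.search q r, T⟩ ⟨.search q r, T'⟩ ∧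
      T' .answer = ⟨cellsOf w, h + k * (side r).toInt⟩ ∧
      T' (aux (.inner (Fin.last (D + 1)))) = ⟨cellsOf (marked m), m⟩ ∧
      T' (aux .ret) = ⟨cellsOf [true], z + k * (side r).toInt⟩ ∧
      ∀ t, t ≠ .answer → t ≠ aux (.inner (Fin.last (D + 1))) → t ≠ aux .ret → T' t = T t := by
  -- As the direction is nonzero, different passes see different cells, and the mark is met in pass
  -- `k` and not earlier.
  have hd : (side r).toInt ≠ 0 := by cases r <;> simp [side, Dir.toInt]
  obtain ⟨T1, h1, e1⟩ := Silent.loop (M := M.clocked D) (φ := φ) (q := .search q r) (T := T) k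
    (fun j hj => if_neg (by
      simp only [Tape.iterate_act_none, hs, Tape.read, scanDir, if_true, cellsOf_marked, ← hk]
      intro e
      have : (j : ℤ) * (side r).toInt = k * (side r).toInt := by linarith
      have := mul_right_cancel₀ hd this
      omega)) rfl
  refine ⟨T1, h1, ?_, ?_, ?_, fun t a b c => ?_⟩
  · simp [e1, ha, Tape.iterate_act_none, scanDir]
  · simp [e1, hs, Tape.iterate_act_none, scanDir, hk]
  · simp [e1, hr, Tape.iterate_act_none, scanDir]
  · have : scanDir r t = .stay := by
      rcases t with _ | _ | _ | _ | k | x | i | _ <;> simp_all [scanDir]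
    simp [e1, this, iterate_act_stay]

/-- The answer head is moved back. -/
theorem silent_resume {q : M.Q} {r : Bool} {k : ℕ} {x h z : ℤ} {b w : Str}
    {T : TapeName (M.K ⊕ Aux D) → Tape} (ha : T .answer = ⟨cellsOf w, h⟩)
    (hs : T (aux (.inner (Fin.last (D + 1)))) = ⟨cellsOf b, x⟩)
    (hr : T (aux .ret) = ⟨cellsOf [true], z⟩) (hk : z + k * (side r).toInt = 0) :
    ∃ T', Silent (M := M.clocked D) φ (k + 1) ⟨.resume q r, T⟩ ⟨.sim q false, T'⟩ ∧
      T' .answer = ⟨cellsOf w, h + k * (side r).toInt⟩ ∧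
      T' (aux (.inner (Fin.last (D + 1)))) = ⟨cellsOf b, x + k * (side r).toInt⟩ ∧
      T' (aux .ret) = Tape.ofStr [true] ∧
      ∀ t, t ≠ .answer → t ≠ aux (.inner (Fin.last (D + 1))) → t ≠ aux .ret → T' t = T t := by
  have hd : (side r).toInt ≠ 0 := by cases r <;> simp [side, Dir.toInt]
  obtain ⟨T1, h1, e1⟩ := Silent.loop (M := M.clocked D) (φ := φ) (q := .resume q r) (T := T) k
    (fun j hj => if_neg (by
      simp only [Tape.iterate_act_none, hr, Tape.read, scanDir, cellsOf_isSome,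
        List.length_singleton]
      intro e
      have : (j : ℤ) * (side r).toInt = k * (side r).toInt := by push_cast at e; omega
      have := mul_right_cancel₀ hd this
      omega)) rfl
  have r1 : T1 (aux .ret) = Tape.ofStr [true] := by
    simp [e1, hr, Tape.iterate_act_none, scanDir, hk, Tape.ofStr]
  obtain ⟨T2, h2, e2⟩ := Silent.go (M := M.clocked D) (φ := φ) (q := .resume q r) (T := T1)
    (if_pos (by simp [r1, Tape.read, Tape.ofStr, cellsOf_isSome])) rfl
  refine ⟨T2, h1.trans h2, ?_, ?_, ?_, fun t a b c => ?_⟩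
  · simp [e2, e1, ha, Tape.iterate_act_none, scanDir, Dir.toInt]
  · simp [e2, e1, hs, Tape.iterate_act_none, scanDir, Dir.toInt]
  · simp [e2, r1, Dir.toInt]
  · have : scanDir r t = .stay := by
      rcases t with _ | _ | _ | _ | k | x | i | _ <;> simp_all [scanDir]
    simp [e2, e1, this, iterate_act_stay, Dir.toInt]

/-- After a query the limit on the answer is found, and the simulation is resumed if the answer
respects the limit. -/
theorem silent_check {q : M.Q} {m y L n : ℕ} {h : ℤ} {b w : Str} (hm : m = y + L) (hh : 0 ≤ y + h)
    {T : TapeName (M.K ⊕ Aux D) → Tape} (ha : T .answer = ⟨cellsOf w, h⟩)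
    (hc : T (aux (.inner (clock D))) = ⟨cellsOf b, n⟩)
    (hs : T (aux (.inner (Fin.last (D + 1)))) = ⟨cellsOf (marked m), y + h⟩)
    (hr : T (aux .ret) = Tape.ofStr [true]) :
    ∃ k : ℕ, (k : ℤ) ≤ L + |h| ∧
    (L < w.length → ∃ c, Silent (M := M.clocked D) φ (k + 1) ⟨.check q, T⟩ c ∧
      (M.clocked D).step φ c = none) ∧
    (w.length ≤ L → ∃ T',
      Silent (M := M.clocked D) φ (2 * k + 3) ⟨.check q, T⟩ ⟨.sim q false, T'⟩ ∧
      T' (aux (.inner (clock D))) = ⟨cellsOf b, n + 1⟩ ∧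
      ∀ t, t ≠ aux (.inner (clock D)) → T' t = T t) := by
  have hcl := clock_ne_last D
  obtain ⟨T1, h1, e1⟩ := Silent.go (M := M.clocked D) (φ := φ) (q := .check q) (T := T) rfl
    (by simp)
  set r := ((T (aux (.inner (Fin.last (D + 1))))).read).isSome with hr'
  obtain ⟨k, hk1, hk⟩ : ∃ k : ℕ, (k : ℤ) ≤ L + |h| ∧ h + k * (side r).toInt = L := by
    refine ⟨(L - h).natAbs, ?_, ?_⟩
    · have := neg_abs_le h
      have := le_abs_self h
      omega
    -- The nonblank cells of the limit tape are `0, …, m`, and its head is not left of cell `0` by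
    -- `hh`. So a nonblank symbol means that the mark lies ahead or under the head.
    · have : r = true ↔ h ≤ L := by
        rw [hr', hs]
        simp only [Tape.read, cellsOf_isSome, length_marked]
        omega
      cases hr : r
      · have h' : ¬ h ≤ L := fun h' => by simp [hr] at this; omega
        simp only [side, Dir.toInt, Bool.false_eq_true, if_false]
        omega
      · have h' : h ≤ L := this.1 hr
        simp only [side, Dir.toInt, if_true]
        omega
  have f1 : ∀ t, t ≠ aux (.inner (clock D)) → T1 t = T t := fun t ht => by
    simp [e1, ht, Dir.toInt]
  obtain ⟨T2, h2, a2, s2, r2, f2⟩ := silent_search (φ := φ) (M := M) (q := q) (r := r) (k := k)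
    (T := T1) (z := 0) (by rw [f1 _ (by simp), ha]) (by rw [f1 _ (by simp [hcl.symm]), hs])
    (by rw [f1 _ (by simp), hr]; rfl) (by rw [hm]; push_cast; linarith)
  rw [hk] at a2
  refine ⟨k, hk1, fun hL => ⟨_, (h1.trans h2).cast (by omega), step_halt ?_⟩, fun hL => ?_⟩
  -- With the limit head on the mark, the answer head is on cell `L`, which is nonblank exactly if
  -- the answer has more than `L` symbols.
  · refine (if_pos ?_).trans (if_pos ?_)
    · simp [s2, Tape.read, cellsOf_marked]
    · simpa [a2, Tape.read, cellsOf_isSome] using hL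
  · obtain ⟨T3, h3, e3⟩ := Silent.go (M := M.clocked D) (φ := φ) (q := .search q r) (T := T2)
      ((if_pos (by simp [s2, Tape.read, cellsOf_marked])).trans
        (if_neg (by simpa [a2, Tape.read, cellsOf_isSome] using hL))) rfl
    simp only [act_stay] at e3
    obtain rfl : T3 = T2 := funext e3
    -- Reversing the direction for the same `k` moves undoes all displacements; the return tape,
    -- whose only symbol is at cell `0`, signals when to stop.
    have hneg : (side !r).toInt = - (side r).toInt := by cases r <;> rfl
    obtain ⟨T4, h4, a4, s4, r4, f4⟩ := silent_resume (φ := φ) (M := M) (q := q) (r := !r) (k := k)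
      a2 s2 r2 (by rw [hneg]; ring)
    refine ⟨T4, (((h1.trans h2).trans h3).trans h4).cast (by omega), ?_, fun t ht => ?_⟩
    · rw [f4 _ (by simp) (by simp [hcl]) (by simp), f2 _ (by simp) (by simp [hcl]) (by simp), e1]
      simp [hc, Dir.toInt]
    · rw [hneg] at a4 s4
      by_cases c1 : t = .answer
      · subst c1
        rw [a4, ha, ← hk]; simp
      by_cases c2 : t = aux (.inner (Fin.last (D + 1)))
      · subst c2
        rw [s4, hs]
        simp [hm, ← hk]
        ring
      by_cases c3 : t = aux .ret
      · subst c3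
        rw [r4, hr]
      rw [f4 t c1 c2 c3, f2 t c1 c2 c3, f1 t ht]

end OracleMachine

theorem pad_succ (φ : Baire) (n i : ℕ) :
    pad φ n (i + 1) = stem φ n (i + 1) + (reply φ n (i + 1)).length := rfl

/-- Used twice: the stem is long enough for the limit head to follow the answer head to the left of
cell `0`, and the query that yields the limit is at least as long as any query made within the
clock. -/
theorem pad_le_stem (φ : Baire) (n i : ℕ) : pad φ n i ≤ stem φ n (i + 1) := by
  simp only [stem]; nlinarith

namespace OracleMachine

variable {M : OracleMachine} {D : ℕ} {φ : Baire}

/-- The inner tape of stage `D`, with its head back on cell `0`, becomes the clock. That of stage `D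
+ 1` becomes the limit tape, with its head behind the stem, aligned with cell `0` of the answer. -/
theorem Ready.sim {a : Str} {T : TapeName (M.K ⊕ Aux D) → Tape}
    (h : Ready M D φ a (D + 1) T) : Sim M D φ a 0 (M.run φ a 0) true T := by
  refine ⟨fun t ht => ?_, ?_, rfl, ?_, h.prev _ rfl, ?_, h.ret, by simp [run, init, Tape.ofStr]⟩
  · cases t
    · exact h.input
    · exact h.query
    · exact absurd rfl ht
    · exact h.output
    · exact h.work _
  · rw [h.answer]; rfl
  · simp [h.answer, Tape.ofStr]
  · rw [h.inner _ rfl]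
    simp [run, init, Tape.ofStr]

theorem step_act {c : M.Config} {q s d}
    (h : M.program c.state (fun t => (c.tape t).read) = .act q s d) :
    M.step φ c = some ⟨q, actTapes c.tape s d⟩ := by
  simp only [step, h]

/-- Two halting times give the same result. -/
theorem HaltedAt.run_eq_run {n m : ℕ} {a : Str} (hn : M.HaltedAt φ a n) (hm : M.HaltedAt φ a m) :
    M.run φ a n = M.run φ a m := by
  rcases le_total n m with h | h
  · exact (hn.run_eq h).symm
  · exact hm.run_eq h

/-- The simulation halts in time and with at most one further length revision. If `M` halts within
the time bound and the oracle answers respect the limit, then the result is that of `M`. -/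
theorem good_sim {a w : Str} {p : ℕ → ℕ} (hp : Monotone p) {v : ℕ}
    (hv : (reply φ a.length (D + 1)).length ≤ v) {H : Prop}
    (hH : H → (∀ b : Str, b.length ≤ pad φ a.length D →
      (φ b).length ≤ (reply φ a.length (D + 1)).length) ∧
      ∃ n ≤ pad φ a.length D, M.HaltedAt φ a n ∧ ((M.run φ a n).tape .output).content = w)
    (m : ℕ) {n : ℕ} {fresh : Bool} {T : TapeName (M.K ⊕ Aux D) → Tape} {t : ℕ}
    (hS : Sim M D φ a n (M.run φ a n) fresh T) (hm : n + m = pad φ a.length D + 1)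
    (ht : t + m * (2 * ((reply φ a.length (D + 1)).length + pad φ a.length D) + 6) ≤ p v) :
    Good (M := M.clocked D) φ p (fun c => H → (c.tape .output).content = w) 1 v t
      ⟨.sim (M.run φ a n).state fresh, T⟩ := by
  induction m generalizing n fresh T t with
  | zero =>
    -- The clock carries `pad φ a.length D + 1` symbols and all are used up. Under `H` the machine
    -- `M` has halted before, so the simulated output is already final.
    refine .halt (step_halt (if_neg ?_)) (fun h => ?_) (by simpa using ht)
    · simp [hS.clock, Tape.read, cellsOf_isSome]
      omega
    · obtain ⟨k, hk, hk', e⟩ := (hH h).2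
      have := hS.other .output (by simp)
      simp only [emb] at this
      rw [hk'.run_eq (by omega)] at this
      exact (congrArg Tape.content this).trans e
  | succ m ih =>
    set P := pad φ a.length D with hP
    set L := (reply φ a.length (D + 1)).length with hL
    have hclock : ((fun t => (T t).read) (aux (.inner (clock D)))).isSome = true := by
      simp [hS.clock, Tape.read, cellsOf_isSome]
      omega
    have hprog : (M.clocked D).program (.sim (M.run φ a n).state fresh) (fun t => (T t).read) =
        _ := if_pos hclock
    rw [hS.view_eq] at hprog
    have hout := hS.other .output (by simp)
    simp only [emb] at hout
    rcases hstep : M.program (M.run φ a n).state (fun t => ((M.run φ a n).tape t).read) with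
      _ | q | ⟨q, s, d⟩ <;> rw [hstep] at hprog
    · refine .halt (step_halt hprog) (fun h => ?_) (by omega)
      obtain ⟨k, hk, hk', e⟩ := (hH h).2
      have h' : M.HaltedAt φ a n := step_halt hstep
      rw [h'.run_eq_run hk'] at hout
      exact (congrArg Tape.content hout).trans e
    · have hrun := M.run_succ_of_step (step_query (φ := φ) hstep)
      set b := (T .query).content with hb
      have hq := hS.other .query (by simp)
      simp only [emb] at hq
      have hbn : b.length ≤ n := by
        rw [hb, hq]
        exact M.length_content_query_le φ a n
      have hans : queryTapes φ T .answer = ⟨cellsOf (φ b), (T .answer).head⟩ := rfl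
      have hhead := hS.head_le
      rw [← hS.head] at hhead
      obtain ⟨k, hk, hlong, hshort⟩ := silent_check (φ := φ) (M := M) (q := q)
        (m := pad φ a.length (D + 1)) (y := stem φ a.length (D + 1)) (L := L) (n := n)
        (h := (T .answer).head) (T := queryTapes φ T) (pad_succ _ _ _)
        (by
          have := pad_le_stem φ a.length D
          have := neg_abs_le (T .answer).head
          omega)
        hans hS.clock (by rw [hS.head]; exact hS.scan) hS.ret
      have hk' : k ≤ L + P := by omega
      have hm1 : (m + 1) * (2 * (L + P) + 6) = m * (2 * (L + P) + 6) + 2 * (L + P) + 6 := by ring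
      rw [hm1] at ht
      have hlen : (queryTapes φ T .answer).content.length = (φ b).length := by rw [hans]; simp
      rcases le_or_gt (φ b).length L with hle | hgt
      · obtain ⟨T', hs', hc', hf'⟩ := hshort hle
        refine .silent (step_query hprog) (hlen.trans_le (hle.trans hv)) (by omega) ?_
        refine .of_silent hs' (hlen.trans_le (hle.trans hv)) (by omega) ?_
        have hq' : q = (M.run φ a (n + 1)).state := by rw [hrun]
        rw [hq']
        refine ih ?_ (by omega) (by omega)
        rw [hrun]
        have hne := clock_ne_last D
        refine ⟨fun t' ht' => ?_, ?_, ?_, ?_, ?_, ?_, ?_, ?_⟩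
        · have ho := hS.other t' ht'
          rw [hf' _ (by cases t' <;> simp [emb])]
          cases t' <;> simp only [emb] at ho
          case answer => exact absurd rfl ht'
          all_goals simp [queryTapes, emb, ho]
        · rw [hf' _ (by simp)]
          exact hS.head
        · rw [hf' _ (by simp)]
          simp only [queryTapes, Tape.overwrite, ← hq]
          rfl
        · rw [hf' _ (by simp), hlen]
          exact hle
        -- A query moves no head; the clock tick for this simulated step is made up for in the state
        -- `check`.
        · rw [hc']; simp
        · rw [hf' _ (by simp [hne.symm])]
          exact hS.scan
        · rw [hf' _ (by simp)]
          exact hS.ret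
        · have := hS.head_le
          simp only [queryTapes, Tape.overwrite]
          push_cast
          omega
      · obtain ⟨c, hs', hc'⟩ := hlong hgt
        have hv' : v ≤ max v (queryTapes φ T .answer).content.length := le_max_left _ _
        have := hp hv'
        -- An overlong answer spends the one remaining revision. The machine halts once this is
        -- detected, and under `H` the case does not arise.
        refine .revise (step_query hprog) (by omega) ?_
        refine .of_silent hs' (le_max_right _ _) ?_ (.halt hc' (fun h => ?_) ?_)
        · refine le_trans ?_ this; omega
        · have := (hH h).1 b (by omega)
          omega
        · refine le_trans ?_ this; omega
    · have hm1 : (m + 1) * (2 * (L + P) + 6) = m * (2 * (L + P) + 6) + 2 * (L + P) + 6 := by ring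
      rw [hm1] at ht
      have hstep' := step_act (φ := φ) hstep
      have hstep'' := step_act (M := M.clocked D) (φ := φ) (c := ⟨_, T⟩) hprog
      have hrun := M.run_succ_of_step hstep'
      refine .silent hstep'' (hS.short.trans hv) (by omega) ?_
      have hq' : q = (M.run φ a (n + 1)).state := by rw [hrun]
      have hS' := hS.act q s d
      rw [← hrun] at hS'
      rw [hq']
      exact ih hS' (by omega) (by omega)

end OracleMachine

/-! ### Polynomial step-count of the clocked machine -/

/-- A bound for `pad` in terms of the length revision. -/
noncomputable def padBound : ℕ → Polynomial ℕ
  | 0 => Polynomial.X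
  | i + 1 => (padBound i + 1) ^ 2 + Polynomial.X

theorem padBound_mono (v : ℕ) : Monotone (fun i => (padBound i).eval v) :=
  monotone_nat_of_le_succ fun i => by
    simp only [padBound, Polynomial.eval_add, Polynomial.eval_pow, Polynomial.eval_one,
      Polynomial.eval_X]
    nlinarith

theorem pad_le_padBound {φ : Baire} {n v : ℕ} (hn : n ≤ v) {i : ℕ}
    (h : ∀ k ≤ i, (reply φ n k).length ≤ v) : pad φ n i ≤ (padBound i).eval v := by
  induction i with
  | zero => simpa [pad, padBound] using hn
  | succ i ih =>
    have h1 := ih fun k hk => h k (hk.trans i.le_succ)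
    have h2 := h (i + 1) le_rfl
    simp only [pad_succ, stem, padBound, Polynomial.eval_add, Polynomial.eval_pow,
      Polynomial.eval_one, Polynomial.eval_X]
    gcongr

/-- A bound for the number of steps in one stage. -/
noncomputable def stageBound (D : ℕ) : Polynomial ℕ :=
  4 * (padBound (D + 1) + 2) ^ 2 + 2 * Polynomial.X + 4

theorem eval_stageBound (D v : ℕ) :
    (stageBound D).eval v = 4 * ((padBound (D + 1)).eval v + 2) ^ 2 + 2 * v + 4 := by
  simp [stageBound]

/-- A step-count of the clocked machine. -/
noncomputable def clockedBound (D : ℕ) : Polynomial ℕ :=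
  (D + 2 : Polynomial ℕ) * stageBound D +
    (padBound (D + 1) + 1) * (2 * (Polynomial.X + padBound (D + 1)) + 6)

theorem eval_clockedBound (D v : ℕ) :
    (clockedBound D).eval v = (D + 2) * (stageBound D).eval v +
      ((padBound (D + 1)).eval v + 1) * (2 * (v + (padBound (D + 1)).eval v) + 6) := by
  simp [clockedBound]

namespace OracleMachine

variable {M : OracleMachine} {D : ℕ} {φ : Baire}

/-- Each of the `m` remaining stages spends one revision, and one is kept for the simulation. The
work before a query is polynomial in the lengths already seen; copying the answer is charged to the
length revised by it. -/
theorem good_stage {a w : Str} {H : Prop}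
    (hH : H → (∀ b : Str, b.length ≤ pad φ a.length D →
      (φ b).length ≤ (reply φ a.length (D + 1)).length) ∧
      ∃ n ≤ pad φ a.length D, M.HaltedAt φ a n ∧ ((M.run φ a n).tape .output).content = w)
    (m : ℕ) {j : ℕ} {i : Fin (D + 2)} (hi : i.1 = j) (hm : j + m = D + 1)
    {T : TapeName (M.K ⊕ Aux D) → Tape} (hT : Ready M D φ a j T) {v t : ℕ} (ha : a.length ≤ v)
    (hv : ∀ k ≤ j, (reply φ a.length k).length ≤ v) (ht : t ≤ (j + 1) * (stageBound D).eval v) :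
    Good (M := M.clocked D) φ (fun n => (clockedBound D).eval n)
      (fun c => H → (c.tape .output).content = w) (m + 1) v t ⟨afterCopy M.start i, T⟩ := by
  have hpad : pad φ a.length j ≤ (padBound (D + 1)).eval v :=
    (pad_le_padBound ha hv).trans (padBound_mono v (by omega))
  have hb : (j + 1) * (stageBound D).eval v ≤ (D + 2) * (stageBound D).eval v :=
    Nat.mul_le_mul_right _ (by omega)
  have hpw := eval_clockedBound D v
  induction m generalizing j i T v t with
  | zero =>
    obtain rfl : j = D + 1 := by omega
    obtain rfl : i = Fin.last (D + 1) := Fin.ext hi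
    simp only [afterCopy, if_true]
    refine good_sim (eval_mono _) (hv _ le_rfl) hH (pad φ a.length D + 1) hT.sim (by omega) ?_
    have h1 := (pad_mono φ a.length (Nat.le_succ D)).trans hpad
    have h2 := hv _ le_rfl
    simp only [hpw]
    refine add_le_add (ht.trans hb) ?_
    gcongr
  | succ m ih =>
    have hlast : i ≠ Fin.last (D + 1) := fun e => by rw [e] at hi; simp at hi; omega
    have hi' : (next i).1 = j + 1 := by
      have : i.1 + 1 < D + 2 := by omega
      simp only [next, dif_pos this]
      omega
    simp only [afterCopy, if_neg hlast]
    obtain ⟨s, c, c', T', hs, h1, h2, h3, h4, h5⟩ := silent_stage (M := M) hi (by omega) hT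
    set v' := max v (reply φ a.length (j + 1)).length with hv'
    have hvv : v ≤ v' := le_max_left _ _
    have hsb := eval_stageBound D v
    have hsb' := eval_stageBound D v'
    have hsm := eval_mono (stageBound D) hvv
    have hpm := eval_mono (clockedBound D) hvv
    have hs' : s ≤ 4 * ((padBound (D + 1)).eval v + 2) ^ 2 := hs.trans (by gcongr)
    have hB : (j + 2) * (stageBound D).eval v ≤ (D + 2) * (stageBound D).eval v :=
      Nat.mul_le_mul_right _ (by omega)
    have hB' : (j + 2) * (stageBound D).eval v' ≤ (D + 2) * (stageBound D).eval v' :=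
      Nat.mul_le_mul_right _ (by omega)
    have hJ : (j + 1) * (stageBound D).eval v ≤ (j + 1) * (stageBound D).eval v' :=
      Nat.mul_le_mul_left _ hsm
    have e1 : (j + 2) * (stageBound D).eval v =
      (j + 1) * (stageBound D).eval v + (stageBound D).eval v := by ring
    have e2 : (j + 2) * (stageBound D).eval v' =
      (j + 1) * (stageBound D).eval v' + (stageBound D).eval v' := by ring
    have hpb := eval_mono (padBound (D + 1)) hvv
    have hsq : 4 * ((padBound (D + 1)).eval v + 2) ^ 2 ≤
        4 * ((padBound (D + 1)).eval v' + 2) ^ 2 := by gcongr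
    have hr : (reply φ a.length (j + 1)).length ≤ v' := le_max_right _ _
    have hpw' := eval_clockedBound D v'
    simp only at hsm hpm
    have hfin : t + s + 1 + (2 * (reply φ a.length (j + 1)).length + 2) ≤
        (j + 1 + 1) * (stageBound D).eval v' := by
      change _ ≤ (j + 2) * (stageBound D).eval v'
      omega
    refine .of_silent h1 ?_ (by omega) (.revise h2 (by omega) ?_)
    · change (T .answer).content.length ≤ v
      rw [hT.answer]
      simpa [Tape.ofStr] using hv j le_rfl
    · rw [h3, ← hv']
      have hk : ∀ k ≤ j + 1, (reply φ a.length k).length ≤ v' := fun k hk => by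
        rcases Nat.le_succ_iff.1 hk with hk | rfl
        · exact (hv k hk).trans hvv
        · exact hr
      refine .of_silent h4 (by rw [h3]; exact hr) ?_ ?_
      · exact hfin.trans (by change (j + 2) * _ ≤ _; omega)
      · exact ih hi' (by omega) h5 (ha.trans hvv) hk hfin
          ((pad_le_padBound (ha.trans hvv) hk).trans (padBound_mono v' (by omega)))
          (Nat.mul_le_mul_right _ (by omega)) hpw'

variable (M D φ) in
-- The proposition `H` lets one induction serve two purposes: `False` gives termination and the
-- resource bounds for arbitrary oracles, `True` gives correctness for oracles in `A`. The D+2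
-- possible revisions account for D+3 values.
theorem clocked_spec (a w : Str) {H : Prop}
    (hH : H → (∀ b : Str, b.length ≤ pad φ a.length D →
      (φ b).length ≤ (reply φ a.length (D + 1)).length) ∧
      ∃ n ≤ pad φ a.length D, M.HaltedAt φ a n ∧ ((M.run φ a n).tape .output).content = w) :
    (∃ n, (M.clocked D).HaltedAt φ a n ∧
      (H → (((M.clocked D).run φ a n).tape .output).content = w)) ∧
    (∀ n : ℕ, (n : ℕ∞) ≤ (M.clocked D).time φ a →
      n ≤ (clockedBound D).eval ((M.clocked D).lengthRevision φ a n)) ∧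
    (Set.range ((M.clocked D).lengthRevision φ a)).encard ≤ (D + 3 : ℕ) := by
  obtain ⟨T, h1, h2⟩ := silent_init (M := M) (D := D) (φ := φ) a
  have hs := eval_stageBound D a.length
  have hc := eval_clockedBound D a.length
  have hB : (stageBound D).eval a.length ≤ (D + 2) * (stageBound D).eval a.length :=
    Nat.le_mul_of_pos_left _ (by omega)
  have hg := good_stage (M := M) hH (D + 1) (j := 0) (i := 0) rfl (by omega) h2 (v := a.length)
    (t := 0 + (2 * a.length + 2)) le_rfl
    (fun k hk => by obtain rfl : k = 0 := by omega
                    simp [reply]) (by rw [zero_add, zero_add, one_mul]; omega)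
  have := (Good.of_silent h1 (by simp [init, Tape.ofStr]) (by omega) hg).spec a rfl rfl
  refine ⟨this.1, fun n hn => this.2.1 n n.zero_le hn, ?_⟩
  have h3 := this.2.2
  have : Set.Ici (0 : ℕ) = Set.univ := by ext; simp
  rw [this, Set.image_univ] at h3
  refine h3.trans_eq ?_
  push_cast
  ring

variable (M D) in
theorem clocked_runsInStrongPolyTime : (M.clocked D).RunsInStrongPolyTimeOn Set.univ :=
  ⟨⟨D + 3, fun φ _ a => (M.clocked_spec D φ a [] (H := False) False.elim).2.2⟩, clockedBound D,
    fun φ _ a => (M.clocked_spec D φ a [] (H := False) False.elim).2.1⟩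

end OracleMachine

/-! ### The equivalences -/

open OracleMachine

theorem PolyTimeComputableOn.hasStrongPolyTimeExtension {A : Set Baire}
    (hA : ∀ φ ∈ A, LengthMonotone φ) {F : A → Baire} (h : PolyTimeComputableOn A F) :
    HasStrongPolyTimeExtension A F := by
  classical
  obtain ⟨M, hM, P, hP, hT⟩ := h
  obtain ⟨D, hD⟩ := exists_le_pad hP
  have hex : ∀ φ a, ∃ w, (M.clocked D).Returns φ a w := fun φ a => by
    obtain ⟨n, hn, -⟩ := (M.clocked_spec D φ a [] (H := False) False.elim).1
    exact ⟨_, n, hn, rfl⟩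
  choose g hg using hex
  -- Outside `A` the extension is whatever the clocked machine outputs; it terminates on every
  -- oracle.
  refine ⟨fun φ => if hφ : φ ∈ A then F ⟨φ, hφ⟩ else g φ, fun φ => by simp, M.clocked D, ?_,
    M.clocked_runsInStrongPolyTime D⟩
  rintro ⟨φ, -⟩ a
  by_cases hφ : φ ∈ A
  · simp only [dif_pos hφ]
    obtain ⟨n, hn, e⟩ := (M.clocked_spec D φ a (F ⟨φ, hφ⟩ a) (H := True) fun _ => by
      refine ⟨fun b hb => hA φ hφ _ _ ?_, pad φ a.length D, le_rfl, ?_⟩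
      · rw [List.length_replicate]
        exact hb.trans (pad_le_stem φ a.length D)
      -- The choice of `D` makes the clock exceed the running time of `M`, so the simulation is
      -- complete.
      · have h1 : M.HaltedAt φ a (pad φ a.length D) := M.haltedAt_of_time_le
          ((hT φ hφ a).trans (by exact_mod_cast hD φ (hA φ hφ) a.length))
        obtain ⟨k, hk, e⟩ := hM ⟨φ, hφ⟩ a
        exact ⟨h1, by rw [h1.run_eq_run hk, e]⟩).1
    exact ⟨n, hn, e trivial⟩
  · simp only [dif_neg hφ]
    exact hg φ a

theorem HasStrongPolyTimeExtension.strongPolyTimeComputableOn {A : Set Baire} {F : A → Baire}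
    (h : HasStrongPolyTimeExtension A F) : StrongPolyTimeComputableOn A F := by
  obtain ⟨G, hG, M, hM, ⟨N, hN⟩, p, hp⟩ := h
  refine ⟨M, fun φ a => ?_, ⟨N, fun φ _ => hN φ trivial⟩, p, fun φ _ => hp φ trivial⟩
  rw [← hG φ]
  exact hM ⟨φ, trivial⟩ a

theorem StrongPolyTimeComputableOn.polyTimeComputableOn {A : Set Baire} {F : A → Baire}
    (h : StrongPolyTimeComputableOn A F) : PolyTimeComputableOn A F := by
  obtain ⟨M, hM, hT⟩ := h
  exact ⟨M, hM, hT.runsInPolyTimeOn⟩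

end OracleComplexity

theorem mainTheorem1 (A : Set OracleComplexity.Baire)
    (hA : ∀ φ ∈ A, OracleComplexity.LengthMonotone φ) (F : A → OracleComplexity.Baire) :
    (OracleComplexity.PolyTimeComputableOn A F ↔
      OracleComplexity.StrongPolyTimeComputableOn A F) ∧
    (OracleComplexity.PolyTimeComputableOn A F ↔
      OracleComplexity.HasStrongPolyTimeExtension A F) :=
  ⟨⟨fun h => (h.hasStrongPolyTimeExtension hA).strongPolyTimeComputableOn,
    fun h => h.polyTimeComputableOn⟩,
    ⟨fun h => h.hasStrongPolyTimeExtension hA,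
      fun h => h.strongPolyTimeComputableOn.polyTimeComputableOn⟩⟩
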